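/- Let $\mathbb K$ be a field of characteristic $0$, let $n\ge 3$, and let $(q_{ij})_{1\le i,j\le n}$ be non-zero scalars in $\mathbb K$ with $q_{ii}=1$ and $q_{ji}=q_{ij}^{-1}$, such that the elements $q_{ij}$ with $i<j$ are algebraically independent over $\mathbb Q$. Let $$R=\mathbb K\langle x_1,\dots,x_n\rangle/(x_ix_j-q_{ij}x_jx_i)$$ be the coordinate algebra of quantum affine $n$-space, graded by $\mathbb Z^n$ with $\deg x_i=e_i$, let $\beta:\mathbb Z^n\times\mathbb Z^n\to\mathbb K^*$ be the bicharacter with $\beta(e_i,e_j)=q_{ij}$, and for $\gamma\in\mathbb Z^n$ let $\sigma_\gamma$ be the automorphism of $R$ with $\sigma_\gamma(r)=\beta(\gamma,d)\,r$ for $r$ homogeneous of degree $d$. Let $\rho_{x_i}:R\to R$ be right multiplication by $x_i$, let $\delta_i:R\to R$ be the $\mathbb K$-linear map with $\delta_i(rs)=\delta_i(r)\sigma_{e_i}(s)+r\delta_i(s)$ for all $r,s\in R$, $\delta_i(x_i)=1$ and $\delta_i(x_j)=0$ for $j\ne i$, and let $\Delta$ be the algebra of operators on $R$ generated by $\rho_{x_1},\dots,\rho_{x_n},\delta_1,\dots,\delta_n$.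 The group $\mathbb Z^n$ acts on $\Delta$ by algebra automorphisms with $\gamma\cdot\rho_{x_i}=\beta(\gamma,e_i)\rho_{x_i}$ and $\gamma\cdot\delta_i=\beta(\gamma,e_i)^{-1}\delta_i$. Let $\Delta\#\mathbb Z^n$ be the skew group algebra, i.e. the free left $\Delta$-module on the symbols $\sigma_\gamma$ ($\gamma\in\mathbb Z^n$) with multiplication $(a\,\sigma_\gamma)(b\,\sigma_{\gamma'})=a\,(\gamma\cdot b)\,\sigma_{\gamma+\gamma'}$. Then $\Delta\#\mathbb Z^n$ is a left and right Noetherian simple domain. The elements $\rho_I\delta_J\sigma_\gamma$, with $I,J\in\mathbb Z_{\ge0}^n$ and $\gamma\in\mathbb Z^n$, where $\rho_I=\rho_{x_1}^{i_1}\cdots\rho_{x_n}^{i_n}$ and $\delta_J=\delta_1^{j_1}\cdots\delta_n^{j_n}$, form a $\mathbb K$-basis of it, and its Gelfand–Kirillov dimension is $3n$. -/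

import Mathlib

/-- A multiplicatively antisymmetric `n × n` matrix of non-zero scalars: `q i i = 1` and
`q j i = (q i j)⁻¹`. -/
structure QMatrix (n : ℕ) (K : Type*) [Field K] where
  q : Fin n → Fin n → Kˣ
  diag : ∀ i, q i i = 1
  anti : ∀ i j, q j i = (q i j)⁻¹

namespace QMatrix

noncomputable section

variable {n : ℕ} {K : Type*} [Field K] (Q : QMatrix n K)

/-- The defining relations `x_i x_j = q_{ij} x_j x_i` of quantum affine `n`-space. -/
inductive Rel : FreeAlgebra K (Fin n) → FreeAlgebra K (Fin n) → Prop
  | comm (i j : Fin n) :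
      Rel (FreeAlgebra.ι K i * FreeAlgebra.ι K j)
        ((Q.q i j : K) • (FreeAlgebra.ι K j * FreeAlgebra.ι K i))

/-- The coordinate algebra `R_n = K⟨x_1, …, x_n⟩ / (x_i x_j - q_{ij} x_j x_i)` of quantum affine
`n`-space. -/
def QSpace : Type _ := RingQuot (Rel Q)

instance instSemiringQSpace : Semiring (QSpace Q) := inferInstanceAs (Semiring (RingQuot (Rel Q)))

instance instAlgebraQSpace : Algebra K (QSpace Q) := inferInstanceAs (Algebra K (RingQuot (Rel Q)))

instance instRingQSpace : Ring (QSpace Q) := Algebra.semiringToRing K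

/-- The canonical projection of the free algebra onto `R_n`. -/
def proj : FreeAlgebra K (Fin n) →ₐ[K] QSpace Q := RingQuot.mkAlgHom K (Rel Q)

theorem proj_surjective : Function.Surjective Q.proj := RingQuot.mkAlgHom_surjective K (Rel Q)

theorem proj_rel {a b : FreeAlgebra K (Fin n)} (h : Rel Q a b) : Q.proj a = Q.proj b :=
  RingQuot.mkAlgHom_rel K h

/-- The generator `x_i` of `R_n`. -/
def x (i : Fin n) : QSpace Q := Q.proj (FreeAlgebra.ι K i)

theorem x_mul_x (i j : Fin n) : Q.x i * Q.x j = (Q.q i j : K) • (Q.x j * Q.x i) := by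
  have h := Q.proj_rel (Rel.comm i j)
  simpa [x] using h

/-- The universal property of `R_n`. -/
def lift {A : Type*} [Ring A] [Algebra K A] (y : Fin n → A)
    (hy : ∀ i j, y i * y j = (Q.q i j : K) • (y j * y i)) : QSpace Q →ₐ[K] A :=
  RingQuot.liftAlgHom K ⟨FreeAlgebra.lift K y, by
    rintro _ _ ⟨i, j⟩
    simpa using hy i j⟩

@[simp]
theorem lift_x {A : Type*} [Ring A] [Algebra K A] (y : Fin n → A)
    (hy : ∀ i j, y i * y j = (Q.q i j : K) • (y j * y i)) (i : Fin n) :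
    Q.lift y hy (Q.x i) = y i := by
  have h := RingQuot.liftAlgHom_mkAlgHom_apply K (FreeAlgebra.lift K y) (s := Rel Q) (by
    rintro _ _ ⟨i, j⟩
    simpa using hy i j) (FreeAlgebra.ι K i)
  rw [FreeAlgebra.lift_ι_apply] at h
  exact h

theorem induct {p : QSpace Q → Prop} (hx : ∀ i, p (Q.x i))
    (hc : ∀ c : K, p (algebraMap K _ c)) (hadd : ∀ r s, p r → p s → p (r + s))
    (hmul : ∀ r s, p r → p s → p (r * s)) (r : QSpace Q) : p r := by
  obtain ⟨f, rfl⟩ := Q.proj_surjective r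
  induction f using FreeAlgebra.induction with
  | grade0 c => simpa using hc c
  | grade1 i => exact hx i
  | mul a b ha hb => rw [map_mul]; exact hmul _ _ ha hb
  | add a b ha hb => rw [map_add]; exact hadd _ _ ha hb

/-- The natural bicharacter `β : ℤⁿ × ℤⁿ → K*` with `β(e_i, e_j) = q_{ij}`. -/
def bichar (a b : Fin n → ℤ) : Kˣ := ∏ i, ∏ j, Q.q i j ^ (a i * b j)

theorem bichar_single_single (i j : Fin n) :
    Q.bichar (Pi.single i 1) (Pi.single j 1) = Q.q i j := by
  classical
  unfold bichar
  rw [Finset.prod_eq_single i, Finset.prod_eq_single j]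
  · simp
  · intro k _ hk; simp [hk]
  · simp
  · intro k _ hk; simp [hk]
  · simp

theorem bichar_add_left (a b c : Fin n → ℤ) :
    Q.bichar (a + b) c = Q.bichar a c * Q.bichar b c := by
  simp [bichar, add_mul, zpow_add, Finset.prod_mul_distrib]

theorem bichar_zero_left (c : Fin n → ℤ) : Q.bichar 0 c = 1 := by
  simp [bichar]

/-- The automorphism `σ_a` of `R_n`, which multiplies a homogeneous element of degree `d` by
`β(a, d)`; it is the algebra map with `σ_a(x_j) = β(a, e_j) x_j`, as `x_j` has degree `e_j`. -/
def sigma (a : Fin n → ℤ) : QSpace Q →ₐ[K] QSpace Q :=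
  Q.lift (fun j => (Q.bichar a (Pi.single j 1) : K) • Q.x j) (by
    intro i j
    simp only [smul_mul_smul_comm]
    rw [Q.x_mul_x i j, smul_smul, smul_smul]
    congr 1
    ring)

theorem sigma_x (a : Fin n → ℤ) (j : Fin n) :
    Q.sigma a (Q.x j) = (Q.bichar a (Pi.single j 1) : K) • Q.x j := by
  simp [sigma]

theorem sigma_add (a b : Fin n → ℤ) (r : QSpace Q) :
    Q.sigma (a + b) r = Q.sigma a (Q.sigma b r) := by
  induction r using Q.induct with
  | hx i => simp [sigma_x, bichar_add_left, smul_smul, mul_comm]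
  | hc c => simp only [AlgHom.commutes]
  | hadd r s hr hs => simp only [map_add, hr, hs]
  | hmul r s hr hs => simp only [map_mul, hr, hs]

theorem sigma_zero (r : QSpace Q) : Q.sigma 0 r = r := by
  induction r using Q.induct with
  | hx i => simp [sigma_x, bichar_zero_left]
  | hc c => simp only [AlgHom.commutes]
  | hadd r s hr hs => simp only [map_add, hr, hs]
  | hmul r s hr hs => simp only [map_mul, hr, hs]

/-- The algebra map `r ↦ !![r, δ_i(r); 0, σ_{e_i}(r)]`; it being multiplicative says that `δ_i` is
a right `σ_{e_i}`-derivation. -/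
def deltaMatrix (i : Fin n) : QSpace Q →ₐ[K] Matrix (Fin 2) (Fin 2) (QSpace Q) :=
  Q.lift (fun j => !![Q.x j, if j = i then 1 else 0; 0, (Q.q i j : K) • Q.x j]) (by
    intro j k
    have h1 := Q.x_mul_x j k
    have h2 : (Q.q i j : K) • Q.x j * (Q.q i k : K) • Q.x k
        = (Q.q j k : K) • ((Q.q i k : K) • Q.x k * (Q.q i j : K) • Q.x j) := by
      simp only [smul_mul_smul_comm]
      rw [h1, smul_smul, smul_smul]
      congr 1
      ring
    have h3 : Q.x j * (if k = i then 1 else 0) + (if j = i then 1 else 0) * (Q.q i k : K) • Q.x k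
        = (Q.q j k : K) • (Q.x k * (if j = i then 1 else 0)
          + (if k = i then 1 else 0) * (Q.q i j : K) • Q.x j) := by
      by_cases hj : j = i <;> by_cases hk : k = i
      · subst hj; subst hk
        simp [Q.diag]
      · subst hj
        simp [hk]
      · subst hk
        simp [hj, smul_smul, Q.anti j k]
      · simp [hj, hk]
    rw [Matrix.mul_fin_two, Matrix.mul_fin_two]
    simp only [mul_zero, zero_mul, zero_add, add_zero, Matrix.smul_of, Matrix.smul_cons,
      Matrix.smul_empty, smul_zero]
    rw [h1, h2, h3])

/-- The operator `δ_i` on `R_n`: the right `σ_{e_i}`-derivation with `δ_i(x_j) = 1` if `j = i`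
and `δ_i(x_j) = 0` otherwise. -/
def delta (i : Fin n) : Module.End K (QSpace Q) where
  toFun r := Q.deltaMatrix i r 0 1
  map_add' r s := by simp
  map_smul' c r := by simp

theorem delta_x (i j : Fin n) : Q.delta i (Q.x j) = if j = i then 1 else 0 := by
  simp [delta, deltaMatrix]

theorem deltaMatrix_eq (i : Fin n) (r : QSpace Q) :
    Q.deltaMatrix i r = !![r, Q.delta i r; 0, Q.sigma (Pi.single i 1) r] := by
  have key : Q.deltaMatrix i r 0 0 = r ∧ Q.deltaMatrix i r 1 0 = 0 ∧
      Q.deltaMatrix i r 1 1 = Q.sigma (Pi.single i 1) r := by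
    induction r using Q.induct with
    | hx j => simp [deltaMatrix, sigma_x, bichar_single_single]
    | hc c => simp [Matrix.algebraMap_matrix_apply]
    | hadd r s hr hs => simp [hr, hs]
    | hmul r s hr hs => simp [Matrix.mul_apply, Fin.sum_univ_two, hr, hs]
  ext u v
  fin_cases u <;> fin_cases v <;> simp [key, delta]

/-- `δ_i` is a right `σ_{e_i}`-derivation. -/
theorem delta_mul (i : Fin n) (r s : QSpace Q) :
    Q.delta i (r * s) = Q.delta i r * Q.sigma (Pi.single i 1) s + r * Q.delta i s := by
  have h : Q.delta i (r * s) = (Q.deltaMatrix i r * Q.deltaMatrix i s) 0 1 := by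
    rw [← map_mul]; rfl
  rw [h, deltaMatrix_eq, deltaMatrix_eq]
  simp [Matrix.mul_apply, Fin.sum_univ_two, add_comm]

theorem delta_algebraMap (i : Fin n) (c : K) : Q.delta i (algebraMap K _ c) = 0 := by
  simp [delta, Matrix.algebraMap_matrix_apply]

/-- The right multiplication operator `ρ_{x_i} : s ↦ s x_i` on `R_n`. -/
def rho (i : Fin n) : Module.End K (QSpace Q) := LinearMap.mulRight K (Q.x i)

/-- The algebra `Δ` of operators on `R_n` generated by the `ρ_{x_i}` and the `δ_i`. -/
def DeltaSub : Subalgebra K (Module.End K (QSpace Q)) :=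
  Algebra.adjoin K (Set.range Q.rho ∪ Set.range Q.delta)

theorem rho_mem (i : Fin n) : Q.rho i ∈ Q.DeltaSub :=
  Algebra.subset_adjoin (Set.mem_union_left _ (Set.mem_range_self i))

theorem delta_mem (i : Fin n) : Q.delta i ∈ Q.DeltaSub :=
  Algebra.subset_adjoin (Set.mem_union_right _ (Set.mem_range_self i))

/-- Conjugation `φ ↦ σ_a φ σ_a⁻¹` of operators on `R_n`. -/
def conj (a : Fin n → ℤ) : Module.End K (QSpace Q) →ₐ[K] Module.End K (QSpace Q) :=
  AlgHom.ofLinearMap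
    { toFun := fun φ => (Q.sigma a).toLinearMap * φ * (Q.sigma (-a)).toLinearMap
      map_add' := fun φ ψ => by simp [mul_add, add_mul]
      map_smul' := fun c φ => by simp }
    (by
      ext r
      simp [← sigma_add, sigma_zero])
    (by
      intro φ ψ
      ext r
      simp [← sigma_add, sigma_zero])

theorem conj_apply (a : Fin n → ℤ) (φ : Module.End K (QSpace Q)) (r : QSpace Q) :
    Q.conj a φ r = Q.sigma a (φ (Q.sigma (-a) r)) := rfl

theorem conj_add (a b : Fin n → ℤ) (φ : Module.End K (QSpace Q)) :
    Q.conj (a + b) φ = Q.conj a (Q.conj b φ) := by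
  ext r
  rw [conj_apply, conj_apply, conj_apply, sigma_add, neg_add_rev, sigma_add]

theorem conj_zero (φ : Module.End K (QSpace Q)) : Q.conj 0 φ = φ := by
  ext r
  rw [conj_apply, neg_zero, sigma_zero, sigma_zero]

/-- `γ · ρ_{x_i} = β(γ, e_i) ρ_{x_i}`. -/
theorem conj_rho (a : Fin n → ℤ) (i : Fin n) :
    Q.conj a (Q.rho i) = (Q.bichar a (Pi.single i 1) : K) • Q.rho i := by
  ext r
  simp [conj_apply, rho, ← sigma_add, sigma_zero, sigma_x]

theorem sigma_delta (a : Fin n → ℤ) (i : Fin n) (r : QSpace Q) :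
    Q.sigma a (Q.delta i r) =
      ((Q.bichar a (Pi.single i 1))⁻¹ : K) • Q.delta i (Q.sigma a r) := by
  induction r using Q.induct with
  | hx j =>
    by_cases h : j = i
    · subst h
      simp [delta_x, sigma_x, smul_smul]
    · simp [delta_x, sigma_x, h]
  | hc c => simp [delta_algebraMap]
  | hadd r s hr hs => simp only [map_add, hr, hs, smul_add]
  | hmul r s hr hs =>
    simp only [map_mul, delta_mul, map_add, hr, hs, smul_add, ← sigma_add, smul_mul_assoc,
      mul_smul_comm, add_comm a]

/-- `γ · δ_i = β(γ, e_i)⁻¹ δ_i`. -/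
theorem conj_delta (a : Fin n → ℤ) (i : Fin n) :
    Q.conj a (Q.delta i) = ((Q.bichar a (Pi.single i 1))⁻¹ : K) • Q.delta i := by
  ext r
  simp [conj_apply, sigma_delta, ← sigma_add, sigma_zero]

theorem conj_mem (a : Fin n → ℤ) {φ : Module.End K (QSpace Q)} (hφ : φ ∈ Q.DeltaSub) :
    Q.conj a φ ∈ Q.DeltaSub := by
  have h : Q.DeltaSub ≤ Q.DeltaSub.comap (Q.conj a) := by
    refine Algebra.adjoin_le ?_
    rintro _ (⟨i, rfl⟩ | ⟨i, rfl⟩)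
    · show Q.conj a (Q.rho i) ∈ Q.DeltaSub
      rw [conj_rho]
      exact Subalgebra.smul_mem _ (Q.rho_mem i) _
    · show Q.conj a (Q.delta i) ∈ Q.DeltaSub
      rw [conj_delta]
      exact Subalgebra.smul_mem _ (Q.delta_mem i) _
  exact h hφ

/-- The algebra `Δ` as a type with its ring and `K`-algebra structure. -/
def Delta : Type _ := Q.DeltaSub

instance instRingDelta : Ring Q.Delta := inferInstanceAs (Ring Q.DeltaSub)

instance instAlgebraDelta : Algebra K Q.Delta := inferInstanceAs (Algebra K Q.DeltaSub)

/-- The inclusion of `Δ` in the algebra of operators on `R_n`. -/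
def Delta.val : Q.Delta →ₐ[K] Module.End K (QSpace Q) := Q.DeltaSub.val

theorem Delta.val_injective : Function.Injective (Delta.val Q) := Subtype.val_injective

/-- The action of `ℤⁿ` (written multiplicatively) on `Δ` by algebra automorphisms:
`γ · φ = σ_γ φ σ_γ⁻¹`, that is `γ · ρ_{x_i} = β(γ, e_i) ρ_{x_i}` and
`γ · δ_i = β(γ, e_i)⁻¹ δ_i`. -/
instance instAction : MulSemiringAction (Multiplicative (Fin n → ℤ)) Q.Delta where
  smul g φ := ⟨Q.conj g.toAdd (Delta.val Q φ), Q.conj_mem _ φ.2⟩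
  one_smul _ := Subtype.ext (Q.conj_zero _)
  mul_smul _ _ _ := Subtype.ext (Q.conj_add _ _ _)
  smul_zero _ := Subtype.ext (map_zero (Q.conj _))
  smul_add _ _ _ := Subtype.ext (map_add (Q.conj _) _ _)
  smul_one _ := Subtype.ext (map_one (Q.conj _))
  smul_mul _ _ _ := Subtype.ext (map_mul (Q.conj _) _ _)

instance instSMulComm : SMulCommClass (Multiplicative (Fin n → ℤ)) K Q.Delta where
  smul_comm g c φ := Subtype.ext (map_smul (Q.conj g.toAdd) c (Delta.val Q φ))

/-- The element `ρ_{x_i}` of `Δ`. -/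
def Delta.rho (i : Fin n) : Q.Delta := ⟨Q.rho i, Q.rho_mem i⟩

/-- The element `δ_i` of `Δ`. -/
def Delta.delta (i : Fin n) : Q.Delta := ⟨Q.delta i, Q.delta_mem i⟩

theorem smul_rho (a : Fin n → ℤ) (i : Fin n) :
    Multiplicative.ofAdd a • Delta.rho Q i
      = (Q.bichar a (Pi.single i 1) : K) • Delta.rho Q i :=
  Subtype.ext (Q.conj_rho a i)

theorem smul_delta (a : Fin n → ℤ) (i : Fin n) :
    Multiplicative.ofAdd a • Delta.delta Q i
      = ((Q.bichar a (Pi.single i 1))⁻¹ : K) • Delta.delta Q i :=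
  Subtype.ext (Q.conj_delta a i)

/-- The ordered monomial `ρ_I = ρ_{x_1}^{i_1} ⋯ ρ_{x_n}^{i_n}` in `Δ`. -/
def rhoMonomial (I : Fin n → ℕ) : Q.Delta := (List.ofFn fun i => Delta.rho Q i ^ I i).prod

/-- The ordered monomial `δ_J = δ_1^{j_1} ⋯ δ_n^{j_n}` in `Δ`. -/
def deltaMonomial (J : Fin n → ℕ) : Q.Delta := (List.ofFn fun i => Delta.delta Q i ^ J i).prod

/-- The skew group algebra `Δ # ℤⁿ`: the free left `Δ`-module on `ℤⁿ` with
`(a g)(b h) = a (g · b) (g h)`. -/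
abbrev SkewGroupAlgebra : Type _ := SkewMonoidAlgebra Q.Delta (Multiplicative (Fin n → ℤ))

end

end QMatrix

/-- The Gelfand–Kirillov dimension of an algebra `A` over a field `K`: the supremum, over the
finite-dimensional subspaces `V` of `A`, of
`limsup_m log (dim (K + V + ⋯ + V^m)) / log m`; here `K + V + ⋯ + V^m = (K + V)^m`. -/
noncomputable def gkDim (K A : Type*) [Field K] [Ring A] [Algebra K A] : EReal :=
  ⨆ V : {V : Submodule K A // FiniteDimensional K V},
    Filter.limsup (fun m : ℕ =>
      ((Real.log (Module.finrank K ((1 ⊔ V.1) ^ m : Submodule K A)) / Real.log m : ℝ) : EReal))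
      Filter.atTop

/-! Two properties of the monomials `ρ_I δ_J` drive everything. They multiply like commuting
monomials: a product of two of them is a non-zero scalar times the monomial with the summed
exponents, plus terms with smaller exponents (`HasLeadingProducts`). And they can be differentiated:
the skew commutators `δ_i f - (e_i · f) δ_i` and `f ρ_i - ρ_i (e_i · f)` lower the exponent of one
`ρ_i` or one `δ_i` by one and multiply by that exponent and a non-zero scalar. The factor is the
ordinary integer, not a q-integer, because `q_ii = 1`; in characteristic zero repeated lowering
therefore takes any non-zero combination to a non-zero constant.

Lowering gives linear independence of the monomials, hence the basis of `Δ # ℤⁿ`. Leading products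
give the Noetherian property through leading exponents and Dickson's lemma; writing `γ` as a
difference of two vectors in `ℕⁿ` brings the group elements under the same argument, which does not
need an independent family. Leading terms also make `Δ` a domain, and unique products in `ℤⁿ` pass
this on to `Δ # ℤⁿ`.

For simplicity, take an element of minimal support in a non-zero two-sided ideal and move it so that
`1` is in the support. Lowering its coefficient at `1` by operations inside the ideal, without
enlarging the support, produces `g` with coefficient `1` there. By minimality `g` commutes with
every `σ_h` and `ρ_i`. So a coefficient `a` of `g` at `x` is fixed by `ℤⁿ` and satisfies `ρ_i a =
β(x, e_i) a ρ_i`. If `β(x, e_i) ≠ 1`, then `a ρ_i` is a multiple of a lowering of `a`, which forces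
`a = 0`. Genericity makes `β` non-degenerate, so such an `i` exists for each `x ≠ 1`; thus `g = 1`.

For the growth, boxes of exponents bound `(K + V)^m` from above, and monomials with all exponents at
most `m / 3n` bound it from below; both counts have order `m^(3n)`. -/

section LeadingProducts

/-! ### Families with leading products: Noetherianity and zero divisors -/

open Submodule

variable {K A ι : Type*} [Field K] [Ring A] [Algebra K A]

/-- Products of members of the family `m` are, up to non-zero scalars and terms with smaller
exponents, the members with the sum of the exponents. -/
def HasLeadingProducts (K : Type*) {A ι : Type*} [Field K] [Ring A] [Algebra K A]
    (m : (ι → ℕ) → A) : Prop :=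
  ∀ a b, ∃ u : K, u ≠ 0 ∧ m a * m b - u • m (a + b) ∈ span K (m '' Set.Iio (a + b))

theorem mem_span_Iic_of_sub_mem {m : (ι → ℕ) → A} {x : A} {u : K} {c : ι → ℕ}
    (h : x - u • m c ∈ span K (m '' Set.Iio c)) : x ∈ span K (m '' Set.Iic c) := by
  rw [← sub_add_cancel x (u • m c)]
  exact add_mem (span_mono (Set.image_mono Set.Iio_subset_Iic_self) h)
    (smul_mem _ _ (subset_span ⟨c, Set.self_mem_Iic, rfl⟩))

theorem HasLeadingProducts.mul_mem {m : (ι → ℕ) → A} (hm : HasLeadingProducts K m)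
    (a b : ι → ℕ) : m a * m b ∈ span K (m '' Set.Iic (a + b)) :=
  let ⟨_, _, h⟩ := hm a b
  mem_span_Iic_of_sub_mem h

theorem HasLeadingProducts.span_mul_span_le {m : (ι → ℕ) → A} (hm : HasLeadingProducts K m)
    (a b : ι → ℕ) :
    span K (m '' Set.Iic a) * span K (m '' Set.Iic b) ≤ span K (m '' Set.Iic (a + b)) := by
  rw [span_mul_span, span_le]
  rintro _ ⟨_, ⟨c, hc, rfl⟩, _, ⟨d, hd, rfl⟩, rfl⟩
  exact span_mono (Set.image_mono (Set.Iic_subset_Iic.2 (add_le_add hc hd))) (hm.mul_mem c d)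

theorem mul_mem_of_mem_span {x f : A} {s : Set A} {P : Submodule K A}
    (hf : f ∈ span K s) (h : ∀ y ∈ s, x * y ∈ P) : x * f ∈ P := by
  have : span K s ≤ P.comap (LinearMap.mulLeft K x) := span_le.2 h
  exact this hf

theorem mul_mem_of_mem_span' {x f : A} {s : Set A} {P : Submodule K A}
    (hf : f ∈ span K s) (h : ∀ y ∈ s, y * x ∈ P) : f * x ∈ P := by
  have : span K s ≤ P.comap (LinearMap.mulRight K x) := span_le.2 h
  exact this hf

/-- It suffices to check left products with generators. -/
theorem HasLeadingProducts.of_generators [Finite ι] [DecidableEq ι] {m : (ι → ℕ) → A}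
    (h1 : m 0 = 1) (g : ι → A)
    (hg : ∀ s a, ∃ u : K, u ≠ 0 ∧ g s * m a - u • m (a + Pi.single s 1) ∈
      span K (m '' Set.Iio (a + Pi.single s 1))) : HasLeadingProducts K m := by
  intro a b
  induction a using WellFoundedLT.induction with
  | ind a ih =>
  by_cases ha : a = 0
  · subst ha
    exact ⟨1, one_ne_zero, by simp [h1]⟩
  obtain ⟨s, hs⟩ : ∃ s, a s ≠ 0 := by
    by_contra! h
    exact ha (funext h)
  obtain ⟨a', rfl⟩ : ∃ a', a = a' + Pi.single s 1 := by
    refine ⟨a - Pi.single s 1, (tsub_add_cancel_of_le ?_).symm⟩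
    intro t
    rcases eq_or_ne t s with rfl | ht
    · simpa using Nat.one_le_iff_ne_zero.2 hs
    · simp [ht]
  have hlt : a' < a' + Pi.single s 1 := lt_add_of_pos_right _ (by simp [Pi.lt_def]; exact ⟨s, by simp⟩)
  obtain ⟨u, hu, hl⟩ := hg s a'
  obtain ⟨v, hv, hv'⟩ := ih a' hlt
  obtain ⟨w, hw, hw'⟩ := hg s (a' + b)
  have hab : a' + b + Pi.single s 1 = a' + Pi.single s 1 + b := by abel
  rw [hab] at hw'
  set a := a' + Pi.single s 1 with hadef
  -- Modulo lower terms `m a` is `u⁻¹ • g s * m a'`, then `m a' * m b` contributes `v` and the final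
  -- `g s` contributes `w`.
  refine ⟨u⁻¹ * (v * w), mul_ne_zero (inv_ne_zero hu) (mul_ne_zero hv hw), ?_⟩
  have e1 : m a * m b - (u⁻¹ * (v * w)) • m (a + b) =
      u⁻¹ • (g s * (m a' * m b - v • m (a' + b)) + v • (g s * m (a' + b) - w • m (a + b))
        - (g s * m a' - u • m a) * m b) := by
    simp only [mul_sub, sub_mul, smul_sub, smul_add, mul_smul_comm, smul_mul_assoc, smul_smul,
      mul_assoc, inv_mul_cancel₀ hu, one_smul]
    abel
  rw [e1]
  refine smul_mem _ _ (sub_mem (add_mem ?_ (smul_mem _ _ hw')) ?_)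
  · refine mul_mem_of_mem_span hv' ?_
    rintro _ ⟨c, hc, rfl⟩
    obtain ⟨w', -, hc'⟩ := hg s c
    refine span_mono (Set.image_mono ?_) (mem_span_Iic_of_sub_mem hc')
    intro d hd
    refine lt_of_le_of_lt (Set.mem_Iic.1 hd) ?_
    rw [← hab]
    exact add_lt_add_left (Set.mem_Iio.1 hc) _
  -- The error in `g s * m a'` involves arbitrary exponents below `a`, which is why the induction is
  -- well-founded rather than one generator at a time.
  · refine mul_mem_of_mem_span' hl ?_
    rintro _ ⟨c, hc, rfl⟩
    obtain ⟨w', -, hc'⟩ := ih c hc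
    refine span_mono (Set.image_mono ?_) (mem_span_Iic_of_sub_mem hc')
    intro d hd
    exact lt_of_le_of_lt (Set.mem_Iic.1 hd) (add_lt_add_left (Set.mem_Iio.1 hc) _)

/-- The span of the members of the family with lexicographically smaller exponents. -/
def lexSpan (K : Type*) {A ι : Type*} [Field K] [Ring A] [Algebra K A] [LinearOrder ι]
    (m : (ι → ℕ) → A) (a : ι → ℕ) : Submodule K A :=
  span K (m '' {c | toLex c < toLex a})

section Lex

variable [LinearOrder ι] {m : (ι → ℕ) → A}

theorem notMem_lexSpan (hi : LinearIndependent K m) (a : ι → ℕ) : m a ∉ lexSpan K m a :=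
  hi.notMem_span_image (lt_irrefl (toLex a))

variable [Finite ι]

theorem span_Iio_le_lexSpan (a : ι → ℕ) : span K (m '' Set.Iio a) ≤ lexSpan K m a :=
  span_mono (Set.image_mono fun _ hc => Pi.toLex_strictMono hc)

theorem span_Iic_le_lexSpan {a b : ι → ℕ} (h : toLex a < toLex b) :
    span K (m '' Set.Iic a) ≤ lexSpan K m b :=
  span_mono (Set.image_mono fun _ hc => lt_of_le_of_lt (Pi.toLex_monotone hc) h)

/-- The lexicographically largest exponent of a chosen finite expression works. The family may be
dependent, so a leading exponent need not be unique. -/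
theorem exists_lead {s : Set (ι → ℕ)} {f : A} (hf : f ∈ span K (m '' s)) (h0 : f ≠ 0) :
    ∃ b ∈ s, ∃ k : K, k ≠ 0 ∧ f - k • m b ∈ lexSpan K m b := by
  classical
  obtain ⟨l, hl, rfl⟩ := (Finsupp.mem_span_image_iff_linearCombination K).1 hf
  have hne : l.support.Nonempty := by
    rw [Finsupp.support_nonempty_iff]
    rintro rfl
    simp at h0
  obtain ⟨b, hb, hmax⟩ := Finset.exists_max_image l.support (fun c => toLex c) hne
  refine ⟨b, (Finsupp.mem_supported K l).1 hl hb, l b, Finsupp.mem_support_iff.1 hb, ?_⟩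
  have e : Finsupp.linearCombination K m l - l b • m b =
      Finsupp.linearCombination K m (l.erase b) := by
    conv_lhs => rw [← Finsupp.single_add_erase b l]
    simp
  rw [e]
  refine (Finsupp.mem_span_image_iff_linearCombination K).2 ⟨_, ?_, rfl⟩
  rw [Finsupp.mem_supported]
  intro c hc
  rw [Finset.mem_coe, Finsupp.support_erase, Finset.mem_erase] at hc
  exact lt_of_le_of_ne (hmax c hc.2) (fun h => hc.1 (toLex.injective h))

/-- Lexicographic order is strictly compatible with addition and refines the product order, so every
cross term and every error term falls below `a + b`. -/
theorem HasLeadingProducts.lead_mul (hm : HasLeadingProducts K m) {a b : ι → ℕ} {f g : A}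
    {k l : K} (hk : k ≠ 0) (hl : l ≠ 0) (hf : f - k • m a ∈ lexSpan K m a)
    (hg : g - l • m b ∈ lexSpan K m b) :
    ∃ u : K, u ≠ 0 ∧ f * g - u • m (a + b) ∈ lexSpan K m (a + b) := by
  obtain ⟨u, hu, huab⟩ := hm a b
  refine ⟨k * l * u, mul_ne_zero (mul_ne_zero hk hl) hu, ?_⟩
  have e : f * g - (k * l * u) • m (a + b) = (f - k • m a) * (g - l • m b) +
      l • ((f - k • m a) * m b) + k • (m a * (g - l • m b)) +
      (k * l) • (m a * m b - u • m (a + b)) := by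
    simp only [mul_sub, sub_mul, smul_sub, mul_smul_comm, smul_mul_assoc, smul_smul]
    rw [mul_comm l k]
    abel
  have key : ∀ c d : ι → ℕ, toLex c + toLex d < toLex a + toLex b →
      m c * m d ∈ lexSpan K m (a + b) :=
    fun c d h => span_Iic_le_lexSpan h (hm.mul_mem c d)
  have h1 : ∀ d, toLex d ≤ toLex b → (f - k • m a) * m d ∈ lexSpan K m (a + b) := by
    intro d hd
    refine mul_mem_of_mem_span' hf ?_
    rintro _ ⟨c, hc, rfl⟩
    exact key c d (add_lt_add_of_lt_of_le hc hd)
  rw [e]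
  refine add_mem (add_mem (add_mem ?_ (smul_mem _ _ (h1 b le_rfl))) (smul_mem _ _ ?_))
    (smul_mem _ _ (span_Iio_le_lexSpan _ huab))
  · refine mul_mem_of_mem_span hg ?_
    rintro _ ⟨d, hd, rfl⟩
    exact h1 d (le_of_lt hd)
  · refine mul_mem_of_mem_span hg ?_
    rintro _ ⟨d, hd, rfl⟩
    exact key a d (add_lt_add_right hd _)

/-- The leading exponents of the elements of a left ideal. -/
def leadExponents (K : Type*) {A ι : Type*} [Field K] [Ring A] [Algebra K A] [LinearOrder ι]
    (m : (ι → ℕ) → A) (I : Submodule A A) : Set (ι → ℕ) :=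
  {a | ∃ f ∈ I, ∃ k : K, k ≠ 0 ∧ f - k • m a ∈ lexSpan K m a}

theorem HasLeadingProducts.isUpperSet_leadExponents (hm : HasLeadingProducts K m)
    (I : Submodule A A) : IsUpperSet (leadExponents K m I) := by
  rintro a b hab ⟨f, hf, k, hk, hfa⟩
  obtain ⟨u, hu, h⟩ := hm.lead_mul (f := m (b - a)) (a := b - a) (k := 1) one_ne_zero hk
    (by simp) hfa
  rw [tsub_add_cancel_of_le hab] at h
  exact ⟨_, I.smul_mem (m (b - a)) hf, u, hu, h⟩

/-- Division algorithm: subtracting an element of `I` with the same leading exponent lowers that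
exponent, and the lexicographic order on finitely many exponents is well-founded. -/
theorem le_of_leadExponents_subset (hs : span K (Set.range m) = ⊤)
    {I I' : Submodule A A} (h : I ≤ I')
    (hE : leadExponents K m I' ⊆ leadExponents K m I) : I' ≤ I := by
  have smem : ∀ (J : Submodule A A) (k : K) {f : A}, f ∈ J → k • f ∈ J := by
    intro J k f hf
    rw [Algebra.smul_def]
    exact J.smul_mem _ hf
  by_contra hcon
  obtain ⟨f, hf', hf⟩ := SetLike.not_le_iff_exists.1 hcon
  have key : ∀ b : Lex (ι → ℕ), ∀ f ∈ I', f ∉ I → ∀ k : K, k ≠ 0 →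
      f - k • m (ofLex b) ∈ lexSpan K m (ofLex b) → False := by
    intro b
    induction b using WellFoundedLT.induction with
    | ind b ih =>
    intro f hf' hf k hk hfb
    obtain ⟨g, hg, l, hl, hgb⟩ := hE ⟨f, hf', k, hk, hfb⟩
    set f₁ := f - (k * l⁻¹) • g with hf₁
    have h1 : f₁ ∈ I' := sub_mem hf' (smem _ _ (h hg))
    have h2 : f₁ ∉ I := fun h2 => hf (by
      have := add_mem h2 (smem I (k * l⁻¹) hg)
      rwa [hf₁, sub_add_cancel] at this)
    have h3 : f₁ ∈ lexSpan K m (ofLex b) := by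
      have e : f₁ = (f - k • m (ofLex b)) - (k * l⁻¹) • (g - l • m (ofLex b)) := by
        rw [smul_sub, smul_smul, mul_assoc, inv_mul_cancel₀ hl, mul_one, hf₁]
        abel
      rw [e]
      exact sub_mem hfb (smul_mem _ _ hgb)
    obtain ⟨c, hc, k', hk', hc'⟩ := exists_lead h3 (fun h0 => h2 (h0 ▸ I.zero_mem))
    exact ih (toLex c) hc f₁ h1 h2 k' hk' hc'
  have hfs : f ∈ span K (m '' Set.univ) := by rw [Set.image_univ, hs]; trivial
  obtain ⟨b, -, k, hk, hb⟩ := exists_lead hfs (fun h0 => hf (h0 ▸ I.zero_mem))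
  exact key (toLex b) f hf' hf k hk hb

end Lex

theorem nonempty_linearOrder (ι : Type*) : Nonempty (LinearOrder ι) :=
  ⟨IsWellOrder.linearOrder WellOrderingRel⟩

theorem HasLeadingProducts.op {m : (ι → ℕ) → A} (hm : HasLeadingProducts K m) :
    HasLeadingProducts K fun a => MulOpposite.op (m a) := by
  intro a b
  obtain ⟨u, hu, h⟩ := hm b a
  refine ⟨u, hu, ?_⟩
  have := mem_map_of_mem (f := (MulOpposite.opLinearEquiv K : A ≃ₗ[K] Aᵐᵒᵖ).toLinearMap) h
  rw [map_span, Set.image_image] at this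
  simpa [add_comm a b] using this

variable [Finite ι] {m : (ι → ℕ) → A}

/-- In a strictly ascending chain each step gains a new leading exponent. By Dickson's lemma a later
one dominates an earlier one, and upward closure then shows that it was not new. -/
theorem HasLeadingProducts.isNoetherianRing (hm : HasLeadingProducts K m)
    (hs : span K (Set.range m) = ⊤) : IsNoetherianRing A := by
  obtain ⟨_⟩ := nonempty_linearOrder ι
  rw [isNoetherianRing_iff, isNoetherian_iff, RelEmbedding.wellFounded_iff_isEmpty]
  refine ⟨fun e => ?_⟩
  have hlt : ∀ {i j : ℕ}, i < j → e i < e j := fun h => e.map_rel_iff.2 h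
  have hle : ∀ {i j : ℕ}, i ≤ j → e i ≤ e j := fun h => by
    rcases h.eq_or_lt with rfl | h
    exacts [le_rfl, (hlt h).le]
  have : ∀ i : ℕ, ∃ a, a ∈ leadExponents K m (e (i + 1)) ∧ a ∉ leadExponents K m (e i) := by
    intro i
    by_contra! h
    exact (hlt i.lt_succ_self).not_ge (le_of_leadExponents_subset hs (hle i.le_succ) h)
  choose a ha ha' using this
  obtain ⟨i, j, hij, h⟩ := wellQuasiOrdered_le a
  refine ha' j (hm.isUpperSet_leadExponents _ h ?_)
  obtain ⟨f, hf, hk⟩ := ha i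
  exact ⟨f, hle (Nat.succ_le_of_lt hij) hf, hk⟩

theorem HasLeadingProducts.isNoetherianRing_op (hm : HasLeadingProducts K m)
    (hs : span K (Set.range m) = ⊤) : IsNoetherianRing Aᵐᵒᵖ := by
  refine hm.op.isNoetherianRing ?_
  have : map (MulOpposite.opLinearEquiv K : A ≃ₗ[K] Aᵐᵒᵖ).toLinearMap
      (span K (Set.range m)) = ⊤ := by
    rw [hs, Submodule.map_top]
    exact LinearEquiv.range _
  rw [map_span, ← Set.range_comp] at this
  exact this

theorem HasLeadingProducts.noZeroDivisors (hm : HasLeadingProducts K m)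
    (hs : span K (Set.range m) = ⊤) (hi : LinearIndependent K m) : NoZeroDivisors A where
  eq_zero_or_eq_zero_of_mul_eq_zero {f g} hfg := by
    obtain ⟨_⟩ := nonempty_linearOrder ι
    by_contra! h
    have top : ∀ x : A, x ∈ span K (m '' Set.univ) := fun x => by
      rw [Set.image_univ, hs]; trivial
    obtain ⟨a, -, k, hk, ha⟩ := exists_lead (top f) h.1
    obtain ⟨b, -, l, hl, hb⟩ := exists_lead (top g) h.2
    obtain ⟨u, hu, hab⟩ := hm.lead_mul hk hl ha hb
    rw [hfg, zero_sub, neg_mem_iff] at hab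
    exact notMem_lexSpan hi _ ((smul_mem_iff _ hu).1 hab)

/-- Right multiplication by a non-constant member of the family raises leading exponents. -/
theorem HasLeadingProducts.eq_zero_of_mul_eq (hm : HasLeadingProducts K m)
    (hs : span K (Set.range m) = ⊤) (hi : LinearIndependent K m) {b : ι → ℕ} (hb : b ≠ 0)
    {D : A →ₗ[K] A} (hD : ∀ c, D (m c) ∈ span K (m '' Set.Iic c)) {f : A}
    (hf : f * m b = D f) : f = 0 := by
  obtain ⟨_⟩ := nonempty_linearOrder ι
  by_contra h0
  obtain ⟨a, -, k, hk, ha⟩ := exists_lead (s := Set.univ) (m := m) (K := K) (f := f)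
    (by rw [Set.image_univ, hs]; trivial) h0
  have hlt : toLex a < toLex (a + b) :=
    Pi.toLex_strictMono (lt_add_of_pos_right _ (pos_iff_ne_zero.2 hb))
  obtain ⟨u, hu, hab⟩ := hm.lead_mul (b := b) (g := m b) hk (one_ne_zero (α := K)) ha (by simp)
  -- `D` cannot raise exponents, whereas `f * m b` has leading exponent `a + b`, strictly above that
  -- of `f`.
  have hDf : D f ∈ lexSpan K m (a + b) := by
    have e : D f = D (f - k • m a) + k • D (m a) := by simp
    rw [e]
    refine add_mem ?_ (smul_mem _ _ (span_Iic_le_lexSpan hlt (hD a)))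
    have : lexSpan K m a ≤ (lexSpan K m (a + b)).comap D := by
      refine span_le.2 ?_
      rintro _ ⟨c, hc, rfl⟩
      exact span_Iic_le_lexSpan (lt_trans hc hlt) (hD c)
    exact this ha
  rw [hf] at hab
  have := sub_mem hDf hab
  rw [sub_sub_cancel] at this
  exact notMem_lexSpan hi _ ((smul_mem_iff _ hu).1 this)

end LeadingProducts

/-! ### Lowering operators: reaching the constants -/

section LoweringOperators

variable {K A ι : Type*} [Field K] [DecidableEq ι]

theorem lowering_apply {u : ι → (ι → ℕ) → K}
    {D : ι → ((ι → ℕ) →₀ K) →ₗ[K] ((ι → ℕ) →₀ K)}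
    (hD : ∀ s a, D s (Finsupp.single a 1) =
      (u s a * a s) • Finsupp.single (a - Pi.single s 1) 1)
    (s : ι) (f : (ι → ℕ) →₀ K) (c : ι → ℕ) :
    D s f c = u s (c + Pi.single s 1) * (c s + 1) * f (c + Pi.single s 1) := by
  induction f using Finsupp.induction_linear with
  | zero => simp
  | add f g hf hg => simp [hf, hg, mul_add]
  | single a k =>
    have e : Finsupp.single a k = k • Finsupp.single a (1 : K) := by simp
    rw [e, map_smul, hD]
    by_cases h : a = c + Pi.single s 1
    · subst h
      simp
      ring
    · rw [Finsupp.smul_apply, Finsupp.smul_apply, Finsupp.smul_apply,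
        Finsupp.single_eq_of_ne (Ne.symm h)]
      -- When `a s = 0` the subtraction is truncated, but the factor `a s` kills the term.
      by_cases ha : a s = 0
      · simp [ha]
      · rw [Finsupp.single_eq_of_ne]
        · simp
        rintro rfl
        refine h (tsub_add_cancel_of_le ?_).symm
        intro t
        rcases eq_or_ne t s with rfl | ht
        · simpa using Nat.one_le_iff_ne_zero.2 ha
        · simp [ht]

/-- Induction on a bound for the total degree: a non-zero `D s f` has smaller degree, and an `f`
killed by all the `D s` is a constant, just as for partial derivatives in characteristic zero. -/
theorem single_zero_mem_of_lowering [CharZero K] [Fintype ι] {u : ι → (ι → ℕ) → K} (hu : ∀ s a, u s a ≠ 0)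
    {D : ι → ((ι → ℕ) →₀ K) →ₗ[K] ((ι → ℕ) →₀ K)}
    (hD : ∀ s a, D s (Finsupp.single a 1) =
      (u s a * a s) • Finsupp.single (a - Pi.single s 1) 1)
    {J : Submodule K ((ι → ℕ) →₀ K)} (hJ : ∀ s, ∀ f ∈ J, D s f ∈ J) {f : (ι → ℕ) →₀ K}
    (hf : f ∈ J) (h0 : f ≠ 0) : Finsupp.single 0 1 ∈ J := by
  obtain ⟨N, hN⟩ : ∃ N, ∀ c ∈ f.support, ∑ s, c s ≤ N :=
    ⟨f.support.sup fun c => ∑ s, c s, fun c hc => Finset.le_sup (f := fun c => ∑ s, c s) hc⟩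
  have const : ∀ f ∈ J, f ≠ 0 → (∀ c, c ≠ 0 → f c = 0) → Finsupp.single 0 1 ∈ J := by
    intro f hf h0 h
    have e : f = Finsupp.single 0 (f 0) := by
      ext c
      by_cases hc : c = 0
      · simp [hc]
      · rw [h c hc, Finsupp.single_eq_of_ne hc]
    have hne : f 0 ≠ 0 := fun h1 => h0 (by rw [e, h1, Finsupp.single_zero])
    have := J.smul_mem (f 0)⁻¹ hf
    rw [e] at this
    simpa [hne] using this
  induction N generalizing f with
  | zero =>
    refine const f hf h0 fun c hc => ?_
    by_contra h
    refine hc (funext fun s => ?_)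
    have := hN c (Finsupp.mem_support_iff.2 h)
    simpa using (Finset.sum_eq_zero_iff.1 (Nat.le_zero.1 this)) s (Finset.mem_univ s)
  | succ N ih =>
    by_cases h : ∃ s, D s f ≠ 0
    · obtain ⟨s, hs⟩ := h
      refine ih (hJ s f hf) hs fun c hc => ?_
      rw [Finsupp.mem_support_iff, lowering_apply hD] at hc
      have := hN _ (Finsupp.mem_support_iff.2 (right_ne_zero_of_mul hc))
      simp only [Pi.add_apply, Finset.sum_add_distrib, Finset.sum_pi_single',
        Finset.mem_univ, if_true] at this
      simpa using this
    · push Not at h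
      refine const f hf h0 fun c hc => ?_
      obtain ⟨s, hs⟩ : ∃ s, c s ≠ 0 := by
        by_contra! h
        exact hc (funext h)
      -- The coefficient of `D s f` at `c - e_s` is a non-zero multiple of `f c`.
      have := DFunLike.congr_fun (h s) (c - Pi.single s 1)
      rw [lowering_apply hD, tsub_add_cancel_of_le] at this
      · have h1 : (((c - Pi.single s 1 : ι → ℕ) s : K) + 1) ≠ 0 := Nat.cast_add_one_ne_zero _
        rw [Finsupp.zero_apply] at this
        exact (mul_eq_zero.1 this).resolve_left (mul_ne_zero (hu _ _) h1)
      · intro t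
        rcases eq_or_ne t s with rfl | ht
        · simpa using Nat.one_le_iff_ne_zero.2 hs
        · simp [ht]

variable [Ring A] [Algebra K A] {m : (ι → ℕ) → A} {u : ι → (ι → ℕ) → K} {D : ι → A →ₗ[K] A}

/-- The lowering operator `a ↦ u_s(a) a_s (a - e_s)` on formal combinations of exponents. -/
noncomputable def formalLowering (u : ι → (ι → ℕ) → K) (s : ι) :
    ((ι → ℕ) →₀ K) →ₗ[K] ((ι → ℕ) →₀ K) :=
  Finsupp.linearCombination K fun a => (u s a * a s) • Finsupp.single (a - Pi.single s 1) 1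

theorem linearCombination_formalLowering
    (hD : ∀ s a, D s (m a) = (u s a * a s) • m (a - Pi.single s 1)) (s : ι)
    (f : (ι → ℕ) →₀ K) :
    Finsupp.linearCombination K m (formalLowering u s f) =
      D s (Finsupp.linearCombination K m f) := by
  induction f using Finsupp.induction_linear with
  | zero => simp
  | add f g hf hg => simp [hf, hg]
  | single a k =>
    rw [formalLowering, Finsupp.linearCombination_single, Finsupp.linearCombination_single,
      map_smul, map_smul, map_smul, hD, Finsupp.linearCombination_single, one_smul]

/-- The non-vanishing assumption is on the formal combination, not on its value in `A`. Hence `J =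
⊥` yields linear independence and a general `J` yields the ideal argument. -/
theorem one_mem_of_comap_lowering [CharZero K] [Fintype ι] (hu : ∀ s a, u s a ≠ 0)
    (hD : ∀ s a, D s (m a) = (u s a * a s) • m (a - Pi.single s 1)) (h1 : m 0 = 1)
    {J : Submodule K A} (hJ : ∀ s, ∀ f ∈ J, D s f ∈ J) {f : (ι → ℕ) →₀ K} (h0 : f ≠ 0)
    (hf : Finsupp.linearCombination K m f ∈ J) : (1 : A) ∈ J := by
  have := single_zero_mem_of_lowering hu (D := formalLowering u)
    (J := J.comap (Finsupp.linearCombination K m))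
    (fun s a => by simp [formalLowering])
    (fun s f hf => by
      rw [Submodule.mem_comap, linearCombination_formalLowering hD]
      exact hJ s _ hf) hf h0
  simpa [h1] using this

theorem linearIndependent_of_lowering [CharZero K] [Fintype ι] [Nontrivial A] (hu : ∀ s a, u s a ≠ 0)
    (hD : ∀ s a, D s (m a) = (u s a * a s) • m (a - Pi.single s 1)) (h1 : m 0 = 1) :
    LinearIndependent K m := by
  rw [linearIndependent_iff]
  intro f hf
  by_contra h0
  have : (1 : A) ∈ (⊥ : Submodule K A) :=
    one_mem_of_comap_lowering hu hD h1 (by simp) h0 (by simpa using hf)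
  exact one_ne_zero ((Submodule.mem_bot K).1 this)

theorem one_mem_of_lowering [CharZero K] [Fintype ι] (hs : Submodule.span K (Set.range m) = ⊤) (hu : ∀ s a, u s a ≠ 0)
    (hD : ∀ s a, D s (m a) = (u s a * a s) • m (a - Pi.single s 1)) (h1 : m 0 = 1)
    {J : Submodule K A} (hJ : ∀ s, ∀ f ∈ J, D s f ∈ J) {f : A} (hf : f ∈ J) (h0 : f ≠ 0) :
    (1 : A) ∈ J := by
  obtain ⟨l, rfl⟩ := (Finsupp.mem_span_range_iff_exists_finsupp).1
    (by rw [hs]; trivial : f ∈ Submodule.span K (Set.range m))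
  refine one_mem_of_comap_lowering hu hD h1 hJ (f := l) ?_ hf
  rintro rfl
  simp at h0

end LoweringOperators

/-! ### Ordered monomials in q-commuting elements and their skew derivatives -/

section OrderedMonomials

variable {K A : Type*} [Field K] [Ring A] [Algebra K A] {n : ℕ}

/-- The ordered monomial `y_1^{a_1} ⋯ y_n^{a_n}`. -/
def orderedMonomial (y : Fin n → A) (a : Fin n → ℕ) : A := (List.ofFn fun i => y i ^ a i).prod

theorem orderedMonomial_zero (y : Fin n → A) : orderedMonomial y 0 = 1 := by
  simp [orderedMonomial]

theorem orderedMonomial_eq_map (y : Fin n → A) (a : Fin n → ℕ) :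
    orderedMonomial y a = ((List.finRange n).map fun i => y i ^ a i).prod := by
  rw [orderedMonomial, List.ofFn_eq_map]

theorem exists_finRange_eq (i : Fin n) :
    ∃ l l', List.finRange n = l ++ i :: l' ∧ i ∉ l ∧ i ∉ l' := by
  obtain ⟨l, l', h⟩ := List.append_of_mem (List.mem_finRange i)
  have hn := List.nodup_finRange n
  rw [h, List.nodup_middle, List.nodup_cons, List.mem_append, not_or] at hn
  exact ⟨l, l', h, hn.1⟩

theorem mul_pow_of_mul_eq_smul {z w : A} {c : K} (h : z * w = c • (w * z)) (k : ℕ) :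
    z * w ^ k = c ^ k • (w ^ k * z) := by
  induction k with
  | zero => simp
  | succ k ih =>
    rw [pow_succ, ← mul_assoc, ih, smul_mul_assoc, mul_assoc, h, mul_smul_comm, smul_smul,
      pow_succ, mul_assoc]

theorem mul_prod_map_pow {y : Fin n → A} {z : A} {c : Fin n → K} (hc : ∀ j, c j ≠ 0)
    (h : ∀ j, z * y j = c j • (y j * z)) (a : Fin n → ℕ) (l : List (Fin n)) :
    ∃ u : K, u ≠ 0 ∧ z * (l.map fun i => y i ^ a i).prod =
      u • ((l.map fun i => y i ^ a i).prod * z) := by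
  induction l with
  | nil => exact ⟨1, one_ne_zero, by simp⟩
  | cons j l ih =>
    obtain ⟨u, hu, e⟩ := ih
    refine ⟨c j ^ a j * u, mul_ne_zero (pow_ne_zero _ (hc j)) hu, ?_⟩
    rw [List.map_cons, List.prod_cons, ← mul_assoc, mul_pow_of_mul_eq_smul (h j), smul_mul_assoc,
      mul_assoc, e, mul_smul_comm, smul_smul, mul_assoc]

theorem map_prod_map_pow {y : Fin n → A} {τ : A →ₐ[K] A} {c : Fin n → K} (hc : ∀ j, c j ≠ 0)
    (h : ∀ j, τ (y j) = c j • y j) (a : Fin n → ℕ) (l : List (Fin n)) :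
    ∃ u : K, u ≠ 0 ∧ τ (l.map fun i => y i ^ a i).prod = u • (l.map fun i => y i ^ a i).prod := by
  induction l with
  | nil => exact ⟨1, one_ne_zero, by simp⟩
  | cons j l ih =>
    obtain ⟨u, hu, e⟩ := ih
    refine ⟨c j ^ a j * u, mul_ne_zero (pow_ne_zero _ (hc j)) hu, ?_⟩
    rw [List.map_cons, List.prod_cons, map_mul, e, map_pow, h, smul_pow, smul_mul_smul_comm]

theorem map_orderedMonomial {y : Fin n → A} {τ : A →ₐ[K] A} {c : Fin n → K} (hc : ∀ j, c j ≠ 0)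
    (h : ∀ j, τ (y j) = c j • y j) (a : Fin n → ℕ) :
    ∃ u : K, u ≠ 0 ∧ τ (orderedMonomial y a) = u • orderedMonomial y a := by
  rw [orderedMonomial_eq_map]
  exact map_prod_map_pow hc h a _

theorem map_pow_congr (y : Fin n → A) {a b : Fin n → ℕ} {i : Fin n} (h : ∀ j ≠ i, a j = b j)
    {l : List (Fin n)} (hl : i ∉ l) :
    (l.map fun i => y i ^ a i) = l.map fun i => y i ^ b i :=
  List.map_congr_left fun j hj => by rw [h j (fun e => hl (e ▸ hj))]

theorem mul_orderedMonomial {y : Fin n → A} {i : Fin n} {c : Fin n → K} (hc : ∀ j, c j ≠ 0)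
    (h : ∀ j, y i * y j = c j • (y j * y i)) (a : Fin n → ℕ) :
    ∃ u : K, u ≠ 0 ∧ y i * orderedMonomial y a = u • orderedMonomial y (a + Pi.single i 1) := by
  obtain ⟨l, l', e, hl, hl'⟩ := exists_finRange_eq i
  obtain ⟨u, hu, hu'⟩ := mul_prod_map_pow hc h a l
  have hcongr : ∀ j ≠ i, (a + Pi.single i 1 : Fin n → ℕ) j = a j := fun j hj => by simp [hj]
  refine ⟨u, hu, ?_⟩
  rw [orderedMonomial_eq_map, orderedMonomial_eq_map, e, List.map_append, List.map_append,
    List.prod_append, List.prod_append, List.map_cons, List.map_cons, List.prod_cons,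
    List.prod_cons, map_pow_congr y hcongr hl, map_pow_congr y hcongr hl', ← mul_assoc, hu',
    smul_mul_assoc, Pi.add_apply, Pi.single_eq_same, pow_succ']
  simp only [mul_assoc]

/-- Follows from left multiplication, since `y i` q-commutes past the whole monomial. -/
theorem orderedMonomial_mul {y : Fin n → A} {i : Fin n} {c : Fin n → K} (hc : ∀ j, c j ≠ 0)
    (h : ∀ j, y i * y j = c j • (y j * y i)) (a : Fin n → ℕ) :
    ∃ u : K, u ≠ 0 ∧ orderedMonomial y a * y i = u • orderedMonomial y (a + Pi.single i 1) := by
  obtain ⟨u, hu, hu'⟩ := mul_orderedMonomial hc h a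
  obtain ⟨v, hv, hv'⟩ := mul_prod_map_pow hc h a (List.finRange n)
  rw [← orderedMonomial_eq_map, hu'] at hv'
  refine ⟨v⁻¹ * u, mul_ne_zero (inv_ne_zero hv) hu, ?_⟩
  rw [mul_smul, hv', smul_smul, inv_mul_cancel₀ hv, one_smul]

variable {D : A →ₗ[K] A} {τ τ' : A →ₐ[K] A}

theorem skewDerivation_one (hD : ∀ f g, D (f * g) = τ f * D g + D f * τ' g) : D 1 = 0 := by
  have := hD 1 1
  simpa using this

theorem skewDerivation_prod (hD : ∀ f g, D (f * g) = τ f * D g + D f * τ' g)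
    (y : Fin n → A) (a : Fin n → ℕ) (l : List (Fin n)) (h : ∀ j ∈ l, D (y j) = 0) :
    D (l.map fun i => y i ^ a i).prod = 0 := by
  have hpow : ∀ j ∈ l, ∀ k : ℕ, D (y j ^ k) = 0 := by
    intro j hj k
    induction k with
    | zero => simpa using skewDerivation_one hD
    | succ k ih => simp [pow_succ, hD, ih, h j hj]
  induction l with
  | nil => simpa using skewDerivation_one hD
  | cons j l ih =>
    rw [List.map_cons, List.prod_cons, hD,
      ih (fun j hj => h j (List.mem_cons_of_mem _ hj))
        (fun j hj => hpow j (List.mem_cons_of_mem _ hj)), hpow j List.mem_cons_self]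
    simp

theorem skewDerivation_orderedMonomial_eq_zero
    (hD : ∀ f g, D (f * g) = τ f * D g + D f * τ' g) {y : Fin n → A} (h : ∀ j, D (y j) = 0)
    (a : Fin n → ℕ) : D (orderedMonomial y a) = 0 := by
  rw [orderedMonomial_eq_map]
  exact skewDerivation_prod hD y a _ fun j _ => h j

/-- Only the block `y i ^ a i` is differentiated; the blocks to its left and right are eigenvectors
of `τ` and `τ'` and contribute the scalar `u`. Two twists are allowed so that both kinds of
commutator are covered. -/
theorem skewDerivation_orderedMonomial (hD : ∀ f g, D (f * g) = τ f * D g + D f * τ' g)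
    {y : Fin n → A} {i : Fin n} (h : ∀ j, D (y j) = if j = i then 1 else 0)
    {c c' : Fin n → K} (hc : ∀ j, c j ≠ 0) (hc' : ∀ j, c' j ≠ 0)
    (hτ : ∀ j, τ (y j) = c j • y j) (hτ' : ∀ j, τ' (y j) = c' j • y j)
    (hi : τ (y i) = y i) (hi' : τ' (y i) = y i) (a : Fin n → ℕ) :
    ∃ u : K, u ≠ 0 ∧ D (orderedMonomial y a) = (u * a i) • orderedMonomial y (a - Pi.single i 1) := by
  obtain ⟨l, l', e, hl, hl'⟩ := exists_finRange_eq i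
  obtain ⟨u, hu, hu'⟩ := map_prod_map_pow hc hτ a l
  obtain ⟨v, hv, hv'⟩ := map_prod_map_pow hc' hτ' a l'
  have h0 : ∀ l : List (Fin n), i ∉ l → D (l.map fun i => y i ^ a i).prod = 0 := fun l hl =>
    skewDerivation_prod hD y a l fun j hj => by
      rw [h, if_neg]
      rintro rfl
      exact hl hj
  -- Both twists fix `y i`, so this is the classical power rule.
  have hpow : ∀ k : ℕ, D (y i ^ k) = (k : K) • y i ^ (k - 1) := by
    intro k
    induction k with
    | zero => simpa using skewDerivation_one hD
    | succ k ih =>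
      rw [pow_succ, hD, map_pow, hi, hi', ih, h, if_pos rfl, mul_one, smul_mul_assoc]
      rcases k with _ | k
      · simp
      · rw [Nat.add_sub_cancel, Nat.add_sub_cancel, ← pow_succ, Nat.cast_succ (k + 1), add_smul,
          one_smul, add_comm]
  have hcongr : ∀ j ≠ i, (a - Pi.single i 1 : Fin n → ℕ) j = a j := fun j hj => by simp [hj]
  refine ⟨u * v, mul_ne_zero hu hv, ?_⟩
  rw [orderedMonomial_eq_map, orderedMonomial_eq_map, e, List.map_append, List.map_append,
    List.prod_append, List.prod_append, List.map_cons, List.map_cons, List.prod_cons,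
    List.prod_cons, map_pow_congr y hcongr hl, map_pow_congr y hcongr hl', hD, hD, h0 l hl,
    h0 l' hl', hu', hv', hpow, mul_zero, zero_add, zero_mul, add_zero, Pi.sub_apply,
    Pi.single_eq_same]
  simp only [mul_smul_comm, smul_mul_assoc, smul_smul, mul_assoc]
  congr 1
  ring

end OrderedMonomials

/-! ### The algebra `Δ`: relations, skew commutators and monomials -/

namespace QMatrix

noncomputable section

variable {n : ℕ} {K : Type*} [Field K] (Q : QMatrix n K)

instance instNontrivialQSpace : Nontrivial (QSpace Q) :=
  (Q.lift (A := K) 0 (by simp)).toRingHom.domain_nontrivial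

instance instNontrivialDelta : Nontrivial Q.Delta :=
  inferInstanceAs (Nontrivial Q.DeltaSub)

theorem delta_mul_x (i j : Fin n) (r : QSpace Q) :
    Q.delta i (r * Q.x j) = (Q.q i j : K) • (Q.delta i r * Q.x j) + if j = i then r else 0 := by
  rw [delta_mul, sigma_x, bichar_single_single, delta_x, mul_smul_comm, mul_ite, mul_one, mul_zero]

theorem delta_delta (i j : Fin n) (r : QSpace Q) :
    Q.delta i (Q.delta j r) = (Q.q j i : K) • Q.delta j (Q.delta i r) := by
  induction r using Q.induct with
  | hx k =>
    have h : ∀ a b : Fin n, Q.delta a (if k = b then 1 else 0) = 0 := fun a b => by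
      split_ifs
      · simpa using Q.delta_algebraMap a 1
      · exact map_zero _
    simp [delta_x, h]
  | hc c => simp [delta_algebraMap]
  | hadd r s hr hs => simp only [map_add, hr, hs, smul_add]
  | hmul r s hr hs =>
    have h := Q.sigma_delta (Pi.single j 1) i s
    have h' := Q.sigma_delta (Pi.single i 1) j s
    rw [bichar_single_single] at h h'
    have h1 : Q.delta i (Q.sigma (Pi.single j 1) s) =
        (Q.q j i : K) • Q.sigma (Pi.single j 1) (Q.delta i s) := by
      rw [h, smul_smul, mul_inv_cancel₀ (Q.q j i).ne_zero, one_smul]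
    have h2 : Q.sigma (Pi.single i 1) (Q.delta j s) =
        (Q.q j i : K) • Q.delta j (Q.sigma (Pi.single i 1) s) := by
      rw [h', Q.anti i j, Units.val_inv_eq_inv_val]
    have h3 : Q.sigma (Pi.single i 1) (Q.sigma (Pi.single j 1) s) =
        Q.sigma (Pi.single j 1) (Q.sigma (Pi.single i 1) s) := by
      rw [← sigma_add, ← sigma_add, add_comm]
    simp only [delta_mul, map_add, hr, hs, h1, h2, h3, smul_add, smul_mul_assoc, mul_smul_comm]
    abel

namespace Delta

theorem rho_mul_rho (i j : Fin n) : rho Q i * rho Q j = (Q.q j i : K) • (rho Q j * rho Q i) := by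
  refine Subtype.ext (LinearMap.ext fun r => ?_)
  change r * Q.x j * Q.x i = (Q.q j i : K) • (r * Q.x i * Q.x j)
  rw [mul_assoc, x_mul_x, mul_smul_comm, mul_assoc]

theorem delta_mul_delta (i j : Fin n) :
    delta Q i * delta Q j = (Q.q j i : K) • (delta Q j * delta Q i) :=
  Subtype.ext (LinearMap.ext fun r => Q.delta_delta i j r)

theorem delta_mul_rho (i j : Fin n) :
    delta Q i * rho Q j = (Q.q i j : K) • (rho Q j * delta Q i) + if j = i then 1 else 0 := by
  refine Subtype.ext (LinearMap.ext fun r => ?_)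
  refine (Q.delta_mul_x i j r).trans ?_
  split_ifs <;> rfl

/-- The action of `e_i ∈ ℤⁿ` on `Δ`. -/
def twist (i : Fin n) : Q.Delta →ₐ[K] Q.Delta :=
  MulSemiringAction.toAlgHom K Q.Delta (Multiplicative.ofAdd (Pi.single i 1 : Fin n → ℤ))

theorem twist_apply (i : Fin n) (f : Q.Delta) :
    twist Q i f = Multiplicative.ofAdd (Pi.single i 1 : Fin n → ℤ) • f := rfl

theorem twist_rho (i j : Fin n) : twist Q i (rho Q j) = (Q.q i j : K) • rho Q j := by
  rw [twist_apply, smul_rho, bichar_single_single]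

theorem twist_delta (i j : Fin n) : twist Q i (delta Q j) = (Q.q j i : K) • delta Q j := by
  rw [twist_apply, smul_delta, bichar_single_single, Q.anti i j, Units.val_inv_eq_inv_val]

theorem twist_rho_self (i : Fin n) : twist Q i (rho Q i) = rho Q i := by
  rw [twist_rho, Q.diag, Units.val_one, one_smul]

theorem twist_delta_self (i : Fin n) : twist Q i (delta Q i) = delta Q i := by
  rw [twist_delta, Q.diag, Units.val_one, one_smul]

/-- The skew derivation `f ↦ f ρ_i - ρ_i (e_i · f)` of `Δ`. -/
def rhoCommutator (i : Fin n) : Q.Delta →ₗ[K] Q.Delta :=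
  LinearMap.mulRight K (rho Q i) - LinearMap.mulLeft K (rho Q i) ∘ₗ (twist Q i).toLinearMap

/-- The skew derivation `f ↦ δ_i f - (e_i · f) δ_i` of `Δ`. -/
def deltaCommutator (i : Fin n) : Q.Delta →ₗ[K] Q.Delta :=
  LinearMap.mulLeft K (delta Q i) - LinearMap.mulRight K (delta Q i) ∘ₗ (twist Q i).toLinearMap

theorem rhoCommutator_apply (i : Fin n) (f : Q.Delta) :
    rhoCommutator Q i f = f * rho Q i - rho Q i * twist Q i f := rfl

theorem deltaCommutator_apply (i : Fin n) (f : Q.Delta) :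
    deltaCommutator Q i f = delta Q i * f - twist Q i f * delta Q i := rfl

theorem rhoCommutator_mul (i : Fin n) (f g : Q.Delta) :
    rhoCommutator Q i (f * g) =
      AlgHom.id K Q.Delta f * rhoCommutator Q i g + rhoCommutator Q i f * twist Q i g := by
  simp only [rhoCommutator_apply, map_mul, AlgHom.id_apply]
  noncomm_ring

theorem deltaCommutator_mul (i : Fin n) (f g : Q.Delta) :
    deltaCommutator Q i (f * g) =
      twist Q i f * deltaCommutator Q i g + deltaCommutator Q i f * AlgHom.id K Q.Delta g := by
  simp only [deltaCommutator_apply, map_mul, AlgHom.id_apply]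
  noncomm_ring

theorem rhoCommutator_rho (i j : Fin n) : rhoCommutator Q i (rho Q j) = 0 := by
  rw [rhoCommutator_apply, twist_rho, mul_smul_comm, rho_mul_rho, sub_self]

theorem rhoCommutator_delta (i j : Fin n) :
    rhoCommutator Q i (delta Q j) = if j = i then 1 else 0 := by
  rw [rhoCommutator_apply, twist_delta, mul_smul_comm, delta_mul_rho, add_sub_cancel_left]
  simp only [eq_comm]

theorem deltaCommutator_rho (i j : Fin n) :
    deltaCommutator Q i (rho Q j) = if j = i then 1 else 0 := by
  rw [deltaCommutator_apply, twist_rho, smul_mul_assoc, delta_mul_rho, add_sub_cancel_left]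

theorem deltaCommutator_delta (i j : Fin n) : deltaCommutator Q i (delta Q j) = 0 := by
  rw [deltaCommutator_apply, twist_delta, smul_mul_assoc, delta_mul_delta, sub_self]

/-- The skew derivations of `Δ` which lower the exponents of the `ρ_i` and of the `δ_i`. -/
def lowering : Fin n ⊕ Fin n → Q.Delta →ₗ[K] Q.Delta :=
  Sum.elim (deltaCommutator Q) (rhoCommutator Q)

/-- The monomial `ρ_I δ_J`, where `I` and `J` are the two parts of the exponent. -/
def monomial (a : Fin n ⊕ Fin n → ℕ) : Q.Delta :=
  Q.rhoMonomial (a ∘ Sum.inl) * Q.deltaMonomial (a ∘ Sum.inr)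

theorem rhoMonomial_eq (I : Fin n → ℕ) : Q.rhoMonomial I = orderedMonomial (rho Q) I := rfl

theorem deltaMonomial_eq (I : Fin n → ℕ) : Q.deltaMonomial I = orderedMonomial (delta Q) I := rfl

theorem monomial_zero : monomial Q 0 = 1 := by
  rw [monomial, rhoMonomial_eq, deltaMonomial_eq, Pi.zero_comp, Pi.zero_comp,
    orderedMonomial_zero, orderedMonomial_zero, mul_one]

theorem add_single_inl_comp_inl (a : Fin n ⊕ Fin n → ℕ) (i : Fin n) :
    (a + Pi.single (Sum.inl i) 1) ∘ Sum.inl = a ∘ Sum.inl + Pi.single i 1 := by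
  ext j; by_cases h : j = i <;> simp [h]

theorem add_single_inl_comp_inr (a : Fin n ⊕ Fin n → ℕ) (i : Fin n) :
    (a + Pi.single (Sum.inl i) 1) ∘ Sum.inr = a ∘ Sum.inr := by
  ext j; simp

theorem add_single_inr_comp_inl (a : Fin n ⊕ Fin n → ℕ) (i : Fin n) :
    (a + Pi.single (Sum.inr i) 1) ∘ Sum.inl = a ∘ Sum.inl := by
  ext j; simp

theorem add_single_inr_comp_inr (a : Fin n ⊕ Fin n → ℕ) (i : Fin n) :
    (a + Pi.single (Sum.inr i) 1) ∘ Sum.inr = a ∘ Sum.inr + Pi.single i 1 := by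
  ext j; by_cases h : j = i <;> simp [h]

theorem sub_single_inl_comp_inl (a : Fin n ⊕ Fin n → ℕ) (i : Fin n) :
    (a - Pi.single (Sum.inl i) 1) ∘ Sum.inl = a ∘ Sum.inl - Pi.single i 1 := by
  ext j; by_cases h : j = i <;> simp [h]

theorem sub_single_inl_comp_inr (a : Fin n ⊕ Fin n → ℕ) (i : Fin n) :
    (a - Pi.single (Sum.inl i) 1) ∘ Sum.inr = a ∘ Sum.inr := by
  ext j; simp

theorem sub_single_inr_comp_inl (a : Fin n ⊕ Fin n → ℕ) (i : Fin n) :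
    (a - Pi.single (Sum.inr i) 1) ∘ Sum.inl = a ∘ Sum.inl := by
  ext j; simp

theorem sub_single_inr_comp_inr (a : Fin n ⊕ Fin n → ℕ) (i : Fin n) :
    (a - Pi.single (Sum.inr i) 1) ∘ Sum.inr = a ∘ Sum.inr - Pi.single i 1 := by
  ext j; by_cases h : j = i <;> simp [h]

/-- Commutation with `δ_i` differentiates the `ρ` half and annihilates the `δ` half; commutation
with `ρ_i` does the reverse. -/
theorem exists_lowering_monomial (s : Fin n ⊕ Fin n) (a : Fin n ⊕ Fin n → ℕ) :
    ∃ u : K, u ≠ 0 ∧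
      lowering Q s (monomial Q a) = (u * a s) • monomial Q (a - Pi.single s 1) := by
  have one : ∀ y : Fin n → Q.Delta, ∀ j, AlgHom.id K Q.Delta (y j) = (1 : K) • y j :=
    fun y j => by simp
  rcases s with i | i
  · obtain ⟨u, hu, e⟩ := skewDerivation_orderedMonomial (deltaCommutator_mul Q i)
      (deltaCommutator_rho Q i) (fun j => (Q.q i j).ne_zero) (fun _ => one_ne_zero)
      (twist_rho Q i) (one _) (twist_rho_self Q i) rfl (a ∘ Sum.inl)
    refine ⟨u, hu, ?_⟩
    rw [monomial, monomial, sub_single_inl_comp_inl, sub_single_inl_comp_inr]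
    refine (deltaCommutator_mul Q i _ _).trans ?_
    rw [rhoMonomial_eq, deltaMonomial_eq, e,
      skewDerivation_orderedMonomial_eq_zero (deltaCommutator_mul Q i)
        (deltaCommutator_delta Q i), mul_zero, zero_add, smul_mul_assoc]
    rfl
  · obtain ⟨u, hu, e⟩ := skewDerivation_orderedMonomial (rhoCommutator_mul Q i)
      (rhoCommutator_delta Q i) (fun _ => one_ne_zero) (fun j => (Q.q j i).ne_zero)
      (one _) (twist_delta Q i) rfl (twist_delta_self Q i) (a ∘ Sum.inr)
    refine ⟨u, hu, ?_⟩
    rw [monomial, monomial, sub_single_inr_comp_inl, sub_single_inr_comp_inr]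
    refine (rhoCommutator_mul Q i _ _).trans ?_
    rw [rhoMonomial_eq, deltaMonomial_eq, e,
      skewDerivation_orderedMonomial_eq_zero (rhoCommutator_mul Q i)
        (rhoCommutator_rho Q i), zero_mul, add_zero, mul_smul_comm]
    rfl

/-- The non-zero scalars by which the lowering operators act on monomials. -/
def loweringScalar (s : Fin n ⊕ Fin n) (a : Fin n ⊕ Fin n → ℕ) : K :=
  (exists_lowering_monomial Q s a).choose

theorem loweringScalar_ne_zero (s : Fin n ⊕ Fin n) (a : Fin n ⊕ Fin n → ℕ) :
    loweringScalar Q s a ≠ 0 :=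
  (exists_lowering_monomial Q s a).choose_spec.1

theorem lowering_monomial (s : Fin n ⊕ Fin n) (a : Fin n ⊕ Fin n → ℕ) :
    lowering Q s (monomial Q a) =
      (loweringScalar Q s a * a s) • monomial Q (a - Pi.single s 1) :=
  (exists_lowering_monomial Q s a).choose_spec.2

theorem linearIndependent_monomial [CharZero K] : LinearIndependent K (monomial Q) :=
  linearIndependent_of_lowering (loweringScalar_ne_zero Q) (lowering_monomial Q) (monomial_zero Q)

theorem exists_smul_monomial (g : Multiplicative (Fin n → ℤ)) (a : Fin n ⊕ Fin n → ℕ) :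
    ∃ u : K, u ≠ 0 ∧ g • monomial Q a = u • monomial Q a := by
  obtain ⟨u, hu, e⟩ := map_orderedMonomial (τ := MulSemiringAction.toAlgHom K Q.Delta g)
    (fun j => (Q.bichar g.toAdd (Pi.single j 1)).ne_zero) (Q.smul_rho g.toAdd) (a ∘ Sum.inl)
  obtain ⟨v, hv, e'⟩ := map_orderedMonomial (τ := MulSemiringAction.toAlgHom K Q.Delta g)
    (fun j => inv_ne_zero (Q.bichar g.toAdd (Pi.single j 1)).ne_zero) (Q.smul_delta g.toAdd)
    (a ∘ Sum.inr)
  refine ⟨u * v, mul_ne_zero hu hv, ?_⟩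
  rw [monomial, smul_mul', ← smul_mul_smul_comm]
  exact congrArg₂ (· * ·) e e'

/-- The generators of `Δ`. -/
def gen : Fin n ⊕ Fin n → Q.Delta := Sum.elim (rho Q) (delta Q)

/-- For `ρ_i` there is no error term. For `δ_i`, moving it to the right end costs exactly one
lowering of the monomial, whose exponent is at most `a`. -/
theorem exists_gen_mul_monomial (s : Fin n ⊕ Fin n) (a : Fin n ⊕ Fin n → ℕ) :
    ∃ u : K, u ≠ 0 ∧ gen Q s * monomial Q a - u • monomial Q (a + Pi.single s 1) ∈
      Submodule.span K (monomial Q '' Set.Iio (a + Pi.single s 1)) := by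
  rcases s with i | i
  · obtain ⟨u, hu, e⟩ := mul_orderedMonomial (y := rho Q) (fun j => (Q.q j i).ne_zero)
      (rho_mul_rho Q i) (a ∘ Sum.inl)
    refine ⟨u, hu, ?_⟩
    have : gen Q (Sum.inl i) * monomial Q a = u • monomial Q (a + Pi.single (Sum.inl i) 1) := by
      rw [monomial, monomial, add_single_inl_comp_inl, add_single_inl_comp_inr, ← mul_assoc,
        ← smul_mul_assoc]
      exact congrArg (· * _) e
    rw [this, sub_self]
    exact zero_mem _
  · obtain ⟨u, hu, e⟩ := orderedMonomial_mul (y := delta Q) (fun j => (Q.q j i).ne_zero)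
      (delta_mul_delta Q i) (a ∘ Sum.inr)
    obtain ⟨v, hv, e'⟩ := exists_smul_monomial Q (Multiplicative.ofAdd (Pi.single i 1)) a
    refine ⟨v * u, mul_ne_zero hv hu, ?_⟩
    have h : gen Q (Sum.inr i) * monomial Q a =
        lowering Q (Sum.inl i) (monomial Q a) + twist Q i (monomial Q a) * delta Q i :=
      (sub_add_cancel _ _).symm
    have h' : twist Q i (monomial Q a) * delta Q i =
        (v * u) • monomial Q (a + Pi.single (Sum.inr i) 1) := by
      rw [twist_apply, e', monomial, monomial, add_single_inr_comp_inl, add_single_inr_comp_inr,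
        smul_mul_assoc, mul_assoc, mul_smul, ← mul_smul_comm u]
      exact congrArg (fun x => v • (_ * x)) e
    have hpos : (0 : Fin n ⊕ Fin n → ℕ) < Pi.single (Sum.inr i) 1 :=
      pos_iff_ne_zero.2 fun h => by simpa using congrFun h (Sum.inr i)
    rw [h, h', add_sub_cancel_right, lowering_monomial]
    refine Submodule.smul_mem _ _ (Submodule.subset_span ⟨_, ?_, rfl⟩)
    exact lt_of_le_of_lt tsub_le_self (lt_add_of_pos_right _ hpos)

theorem hasLeadingProducts : HasLeadingProducts K (monomial Q) :=
  .of_generators (monomial_zero Q) (gen Q) (exists_gen_mul_monomial Q)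

/-- The span contains `1` and is stable under left multiplication by the generators, hence by all of
`Δ`. -/
theorem span_monomial : Submodule.span K (Set.range (monomial Q)) = ⊤ := by
  have hgen : ∀ s, ∀ f ∈ Submodule.span K (Set.range (monomial Q)),
      gen Q s * f ∈ Submodule.span K (Set.range (monomial Q)) := by
    intro s f hf
    refine mul_mem_of_mem_span hf ?_
    rintro _ ⟨a, rfl⟩
    obtain ⟨u, -, h⟩ := exists_gen_mul_monomial Q s a
    exact Submodule.span_mono (Set.image_subset_range _ _) (mem_span_Iic_of_sub_mem h)
  have key : ∀ φ (hφ : φ ∈ Q.DeltaSub), ∀ f ∈ Submodule.span K (Set.range (monomial Q)),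
      (show Q.Delta from ⟨φ, hφ⟩) * f ∈ Submodule.span K (Set.range (monomial Q)) := by
    intro φ hφ
    induction hφ using Algebra.adjoin_induction with
    | mem φ h =>
      rcases h with ⟨i, rfl⟩ | ⟨i, rfl⟩
      · exact hgen (Sum.inl i)
      · exact hgen (Sum.inr i)
    | algebraMap c =>
      intro f hf
      have : (algebraMap K Q.Delta c) * f ∈ Submodule.span K (Set.range (monomial Q)) := by
        rw [← Algebra.smul_def]
        exact Submodule.smul_mem _ _ hf
      exact this
    | add φ ψ hφ hψ h h' =>
      intro f hf
      have := add_mem (h f hf) (h' f hf)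
      rw [← add_mul] at this
      exact this
    | mul φ ψ hφ hψ h h' =>
      intro f hf
      have := h _ (h' f hf)
      rw [← mul_assoc] at this
      exact this
  refine eq_top_iff.2 fun f _ => ?_
  have := key f.1 f.2 1 (Submodule.subset_span ⟨0, monomial_zero Q⟩)
  rwa [mul_one] at this

end Delta

end

end QMatrix

/-! ### Gelfand–Kirillov dimension from polynomial growth bounds -/

section GKDim

open Filter Topology

variable {K A : Type*} [Field K] [Ring A] [Algebra K A]

theorem tendsto_affine_log_div_log (c d : ℝ) :
    Tendsto (fun m : ℕ => (((c + d * Real.log m) / Real.log m : ℝ) : EReal)) atTop (𝓝 (d : EReal)) := by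
  refine (continuous_coe_real_ereal.tendsto d).comp ?_
  have hlog : Tendsto (fun m : ℕ => Real.log m) atTop atTop :=
    Real.tendsto_log_atTop.comp tendsto_natCast_atTop_atTop
  have h : Tendsto (fun m : ℕ => c / Real.log m + d) atTop (𝓝 (0 + d)) :=
    (hlog.const_div_atTop c).add_const d
  rw [zero_add] at h
  refine h.congr' ?_
  filter_upwards [hlog.eventually_gt_atTop 0] with m hm
  rw [add_div, mul_div_assoc, div_self hm.ne', mul_one]

theorem limsup_log_div_log_le {f : ℕ → ℕ} {C d : ℕ} (hC : 0 < C)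
    (h : ∀ m, 1 ≤ m → f m ≤ C * m ^ d) :
    limsup (fun m : ℕ => ((Real.log (f m) / Real.log m : ℝ) : EReal)) atTop ≤ (d : EReal) := by
  have ht := (tendsto_affine_log_div_log (Real.log C) d).limsup_eq
  have hd : (((d : ℝ) : EReal)) = (d : EReal) := rfl
  rw [← hd, ← ht]
  refine limsup_le_limsup ?_
  filter_upwards [eventually_ge_atTop 2] with m hm
  have hm0 : (0 : ℝ) < m := by positivity
  have hlog : 0 < Real.log m := Real.log_pos (by exact_mod_cast hm)
  refine EReal.coe_le_coe_iff.2 (div_le_div_of_nonneg_right ?_ hlog.le)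
  have hC' : (0 : ℝ) < C := by positivity
  have e : Real.log C + d * Real.log m = Real.log ((C * m ^ d : ℕ) : ℝ) := by
    push_cast
    rw [Real.log_mul hC'.ne' (pow_pos hm0 d).ne', Real.log_pow]
  rw [e]
  -- For `f m = 0` the convention `log 0 = 0` keeps the bound true.
  rcases Nat.eq_zero_or_pos (f m) with h0 | h0
  · rw [h0, Nat.cast_zero, Real.log_zero]
    exact Real.log_natCast_nonneg _
  · exact Real.log_le_log (by exact_mod_cast h0) (by exact_mod_cast h m (by omega))

theorem le_limsup_log_div_log {f : ℕ → ℕ} {C d : ℕ} (hC : 0 < C)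
    (h : ∀ m, 1 ≤ m → m ^ d ≤ C * f m) :
    (d : EReal) ≤ limsup (fun m : ℕ => ((Real.log (f m) / Real.log m : ℝ) : EReal)) atTop := by
  have ht := (tendsto_affine_log_div_log (-Real.log C) d).limsup_eq
  have hd : (((d : ℝ) : EReal)) = (d : EReal) := rfl
  rw [← hd, ← ht]
  refine limsup_le_limsup ?_
  filter_upwards [eventually_ge_atTop 2] with m hm
  have hm0 : (0 : ℝ) < m := by positivity
  have hlog : 0 < Real.log m := Real.log_pos (by exact_mod_cast hm)
  refine EReal.coe_le_coe_iff.2 (div_le_div_of_nonneg_right ?_ hlog.le)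
  have hC' : (0 : ℝ) < C := by positivity
  have hf : f m ≠ 0 := by
    intro h0
    have := h m (by omega)
    rw [h0, mul_zero] at this
    exact (pow_pos (by omega : 0 < m) d).ne' (Nat.le_zero.1 this)
  have hf' : (f m : ℝ) ≠ 0 := by exact_mod_cast hf
  have e : Real.log (C * f m) = Real.log C + Real.log (f m) := Real.log_mul hC'.ne' hf'
  have e' : d * Real.log m = Real.log ((m : ℝ) ^ d) := (Real.log_pow _ _).symm
  have : Real.log ((m : ℝ) ^ d) ≤ Real.log (C * f m) :=
    Real.log_le_log (by positivity) (by exact_mod_cast h m (by omega))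
  linarith

theorem gkDim_eq_of_growth {d : ℕ}
    (hu : ∀ V : Submodule K A, FiniteDimensional K V → ∃ C : ℕ, 0 < C ∧ ∀ m, 1 ≤ m →
      Module.finrank K ((1 ⊔ V) ^ m : Submodule K A) ≤ C * m ^ d)
    (hl : ∃ V : Submodule K A, FiniteDimensional K V ∧ ∃ C : ℕ, 0 < C ∧ ∀ m, 1 ≤ m →
      m ^ d ≤ C * Module.finrank K ((1 ⊔ V) ^ m : Submodule K A)) :
    gkDim K A = (d : EReal) := by
  refine le_antisymm (iSup_le fun V => ?_) ?_
  · obtain ⟨C, hC, h⟩ := hu V.1 V.2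
    exact limsup_log_div_log_le hC h
  · obtain ⟨V, hV, C, hC, h⟩ := hl
    exact (le_limsup_log_div_log hC h).trans (le_iSup_of_le ⟨V, hV⟩ le_rfl)

end GKDim

/-! ### Multiplicative independence of algebraically independent elements -/

section AlgebraicIndependence

/-- Moving the negative exponents to the other side gives two monomials with equal values, which
must then be the same monomial. -/
theorem AlgebraicIndependent.eq_zero_of_prod_zpow_eq_one {K ι : Type*} [Field K] [Algebra ℚ K]
    [Fintype ι] {y : ι → K} (hy : AlgebraicIndependent ℚ y) {k : ι → ℤ}
    (h : ∏ i, y i ^ k i = 1) : k = 0 := by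
  have hy0 : ∀ i, y i ≠ 0 := fun i => hy.ne_zero i
  have hpos : ∏ i, y i ^ (k i).toNat = ∏ i, y i ^ (-k i).toNat := by
    have : ∀ i, y i ^ (k i).toNat = y i ^ k i * y i ^ (-k i).toNat := fun i => by
      rw [← zpow_natCast, ← zpow_natCast, ← zpow_add₀ (hy0 i)]
      congr 1
      omega
    rw [Finset.prod_congr rfl fun i _ => this i, Finset.prod_mul_distrib, h, one_mul]
  have key : ∀ a : ι → ℕ, MvPolynomial.aeval y
      (MvPolynomial.monomial (Finsupp.equivFunOnFinite.symm a) (1 : ℚ)) = ∏ i, y i ^ a i := by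
    intro a
    rw [MvPolynomial.aeval_monomial, map_one, one_mul, Finsupp.prod_fintype _ _ (by simp)]
    rfl
  have := hy (a₁ := MvPolynomial.monomial (Finsupp.equivFunOnFinite.symm fun i => (k i).toNat) 1)
    (a₂ := MvPolynomial.monomial (Finsupp.equivFunOnFinite.symm fun i => (-k i).toNat) 1)
    (by rw [key, key, hpos])
  have := Finsupp.equivFunOnFinite.symm.injective
    (MvPolynomial.monomial_left_injective one_ne_zero this)
  ext i
  have := congrFun this i
  simp only [Pi.zero_apply] at this ⊢
  omega

end AlgebraicIndependence

/-! ### Coefficients and zero divisors in skew group rings -/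

namespace SkewMonoidAlgebra

variable {k G : Type*}

theorem coeff_mul_mul_of_uniqueMul [Semiring k] [Monoid G] [MulSemiringAction G k]
    {f g : SkewMonoidAlgebra k G} {a b : G} (ha : a ∈ f.support)
    (h : UniqueMul f.support g.support a b) :
    (f * g).coeff (a * b) = f.coeff a * a • g.coeff b := by
  classical
  rw [coeff_mul, sum_def', Finset.sum_eq_single a, sum_def', Finset.sum_eq_single b]
  · rw [if_pos rfl]
  · intro c hc hcb
    rw [if_neg]
    intro e
    exact hcb (h ha hc e).2
  · intro hb
    rw [notMem_support_iff.1 hb, smul_zero, mul_zero, ite_self]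
  · intro c hc hca
    rw [sum_def']
    refine Finset.sum_eq_zero fun d hd => ?_
    rw [if_neg]
    exact fun e => hca (h hc hd e).1
  · exact fun ha' => absurd ha ha'

theorem noZeroDivisors [Ring k] [Group G] [MulSemiringAction G k] [NoZeroDivisors k]
    [UniqueProds G] : NoZeroDivisors (SkewMonoidAlgebra k G) where
  eq_zero_or_eq_zero_of_mul_eq_zero {f g} hfg := by
    by_contra! h
    obtain ⟨a, ha, b, hb, hab⟩ := UniqueProds.uniqueMul_of_nonempty
      (Finset.nonempty_iff_ne_empty.2 (mt support_eq_empty.1 h.1))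
      (Finset.nonempty_iff_ne_empty.2 (mt support_eq_empty.1 h.2))
    have := coeff_mul_mul_of_uniqueMul ha hab
    rw [hfg, coeff_zero, Finsupp.zero_apply] at this
    rcases mul_eq_zero.1 this.symm with h0 | h0
    · exact mem_support_iff.1 ha h0
    · exact mem_support_iff.1 hb ((smul_eq_zero_iff_eq a).1 h0)

/-- As the group is commutative, conjugation acts coefficientwise and does not move the support; the
simplicity argument rests on this. -/
theorem coeff_conj_single [Ring k] [CommGroup G] [MulSemiringAction G k] (h x : G)
    (f : SkewMonoidAlgebra k G) :
    (single h (1 : k) * f * single h⁻¹ 1).coeff x = h • f.coeff x := by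
  rw [coeff_mul_single, coeff_single_mul, smul_one, one_mul, mul_one, inv_inv, mul_comm x h,
    inv_mul_cancel_left]

end SkewMonoidAlgebra

/-! ### Non-degeneracy of the bicharacter; basis, Noetherianity and domain property of `Δ # ℤⁿ` -/

namespace QMatrix

noncomputable section

variable {n : ℕ} {K : Type*} [Field K] (Q : QMatrix n K)

open SkewMonoidAlgebra

theorem bichar_single_right (a : Fin n → ℤ) (j : Fin n) :
    Q.bichar a (Pi.single j 1) = ∏ i, Q.q i j ^ a i := by
  unfold bichar
  refine Finset.prod_congr rfl fun i _ => ?_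
  rw [Finset.prod_eq_single j]
  · simp
  · intro k _ hk
    simp [hk]
  · simp

/-- The bicharacter of generic parameters is non-degenerate. -/
theorem eq_zero_of_bichar_eq_one [CharZero K] (hn : 2 ≤ n)
    (hq : AlgebraicIndependent ℚ
      (fun p : {p : Fin n × Fin n // p.1 < p.2} => (Q.q p.1.1 p.1.2 : K)))
    {a : Fin n → ℤ} (h : ∀ j, Q.bichar a (Pi.single j 1) = 1) : a = 0 := by
  have key : ∀ j i : Fin n, i ≠ j → a i = 0 := by
    intro j
    -- `β(a, e_j)` is a product of the `q_ij ^ a_i`. For fixed `j` the factors with `i ≠ j` are, up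
    -- to inversion, distinct independent parameters; the sign in `k` records the inversion.
    let pr : {i : Fin n // i ≠ j} → {p : Fin n × Fin n // p.1 < p.2} := fun i =>
      if hij : i.1 < j then ⟨(i.1, j), hij⟩
      else ⟨(j, i.1), lt_of_le_of_ne (not_lt.1 hij) i.2.symm⟩
    have hpr : Function.Injective pr := by
      rintro ⟨i, hi⟩ ⟨i', hi'⟩ e
      have e' := congrArg Subtype.val e
      simp only [pr] at e'
      split_ifs at e' <;> simp_all
    have hy := hq.comp pr hpr
    let k : {i : Fin n // i ≠ j} → ℤ := fun i => if i.1 < j then a i.1 else - a i.1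
    have hk : ∏ i, (Q.q (pr i).1.1 (pr i).1.2 : K) ^ k i = 1 := by
      have h1 : ∀ i : {i : Fin n // i ≠ j},
          (Q.q (pr i).1.1 (pr i).1.2 : K) ^ k i = ((Q.q i.1 j ^ a i.1 : Kˣ) : K) := by
        intro i
        by_cases hij : i.1 < j
        · simp [pr, k, hij]
        · simp [pr, k, hij, Q.anti i.1 j]
      rw [Finset.prod_congr rfl fun i _ => h1 i, ← Units.coe_prod]
      have h2 := h j
      rw [bichar_single_right] at h2
      rw [← Units.val_one, ← h2]
      congr 1
      rw [← Finset.prod_erase Finset.univ (a := j) (by rw [Q.diag, one_zpow])]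
      exact (Finset.prod_subtype (Finset.univ.erase j) (by simp) fun i => Q.q i j ^ a i).symm
    have hk0 := AlgebraicIndependent.eq_zero_of_prod_zpow_eq_one hy hk
    intro i hi
    have := congrFun hk0 ⟨i, hi⟩
    simp only [k, Pi.zero_apply] at this
    split_ifs at this <;> omega
  ext i
  have : Nontrivial (Fin n) := Fin.nontrivial_iff_two_le.2 hn
  obtain ⟨j, hj⟩ := exists_ne i
  exact key j i hj.symm

/-- The basis of `Δ` given by the ordered monomials. -/
def deltaBasis [CharZero K] : Module.Basis (Fin n ⊕ Fin n → ℕ) K Q.Delta :=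
  Module.Basis.mk (Delta.linearIndependent_monomial Q) (Delta.span_monomial Q).ge

/-- The basis of `Δ # ℤⁿ` given by the elements `ρ_I δ_J σ_γ`. -/
def skewBasis [CharZero K] :
    Module.Basis ((Fin n → ℕ) × (Fin n → ℕ) × (Fin n → ℤ)) K Q.SkewGroupAlgebra :=
  ((Finsupp.basis fun _ : Multiplicative (Fin n → ℤ) => Q.deltaBasis).map
    (coeffLinearEquiv (S := K)).symm).reindex
    ((Equiv.sigmaEquivProd _ _).trans ((Equiv.prodComm _ _).trans
      ((Equiv.prodCongr (Equiv.sumArrowEquivProdArrow _ _ _) Multiplicative.toAdd).trans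
        (Equiv.prodAssoc _ _ _))))

theorem skewBasis_apply [CharZero K] (I J : Fin n → ℕ) (γ : Fin n → ℤ) :
    Q.skewBasis (I, J, γ) = single (Multiplicative.ofAdd γ) (Q.rhoMonomial I * Q.deltaMonomial J) := by
  rw [skewBasis, Module.Basis.reindex_apply, Module.Basis.map_apply, Finsupp.coe_basis]
  simp only [deltaBasis, Module.Basis.coe_mk]
  rfl

theorem single_mul_single_mul_single (I J : Fin n → ℕ) (γ : Fin n → ℤ) :
    (single 1 (Q.rhoMonomial I) * single 1 (Q.deltaMonomial J) *
      single (Multiplicative.ofAdd γ) 1 : Q.SkewGroupAlgebra) =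
      single (Multiplicative.ofAdd γ) (Q.rhoMonomial I * Q.deltaMonomial J) := by
  rw [single_mul_single, single_mul_single, one_smul, smul_one, mul_one, mul_one, one_mul]

/-- The part in `ℤⁿ` of an exponent, as the difference of two parts in `ℕⁿ`. -/
def groupPart (a : (Fin n ⊕ Fin n) ⊕ (Fin n ⊕ Fin n) → ℕ) : Fin n → ℤ :=
  fun i => (a (Sum.inr (Sum.inl i)) : ℤ) - a (Sum.inr (Sum.inr i))

/-- The elements `ρ_I δ_J σ_γ` of `Δ # ℤⁿ`, with `γ` written as a difference. -/
def skewMonomial (a : (Fin n ⊕ Fin n) ⊕ (Fin n ⊕ Fin n) → ℕ) : Q.SkewGroupAlgebra :=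
  single (Multiplicative.ofAdd (groupPart a)) (Delta.monomial Q (a ∘ Sum.inl))

theorem groupPart_add (a b : (Fin n ⊕ Fin n) ⊕ (Fin n ⊕ Fin n) → ℕ) :
    groupPart (a + b) = groupPart a + groupPart b := by
  ext i
  simp only [groupPart, Pi.add_apply]
  push_cast
  ring

/-- The group acts on monomials by scalars, so the leading term in `Δ` survives and the group parts
simply add. -/
theorem hasLeadingProducts_skewMonomial : HasLeadingProducts K Q.skewMonomial := by
  intro a b
  obtain ⟨v, hv, e⟩ := Delta.exists_smul_monomial Q (Multiplicative.ofAdd (groupPart a))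
    (b ∘ Sum.inl)
  obtain ⟨u, hu, h⟩ := Delta.hasLeadingProducts Q (a ∘ Sum.inl) (b ∘ Sum.inl)
  refine ⟨v * u, mul_ne_zero hv hu, ?_⟩
  have hg : Multiplicative.ofAdd (groupPart a) * Multiplicative.ofAdd (groupPart b) =
      Multiplicative.ofAdd (groupPart (a + b)) := by
    rw [groupPart_add]
    rfl
  have e1 : Q.skewMonomial a * Q.skewMonomial b - (v * u) • Q.skewMonomial (a + b) =
      v • lsingle K (Multiplicative.ofAdd (groupPart (a + b)))
        (Delta.monomial Q (a ∘ Sum.inl) * Delta.monomial Q (b ∘ Sum.inl) -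
          u • Delta.monomial Q (a ∘ Sum.inl + b ∘ Sum.inl)) := by
    rw [skewMonomial, skewMonomial, single_mul_single, e, hg, mul_smul_comm, map_sub, smul_sub,
      map_smul, smul_smul, lsingle_apply, lsingle_apply, smul_single]
    rfl
  rw [e1]
  refine Submodule.smul_mem _ _ ?_
  have := Submodule.mem_map_of_mem
    (f := lsingle K (Multiplicative.ofAdd (groupPart (a + b)))) h
  rw [Submodule.map_span, Set.image_image] at this
  refine Submodule.span_mono ?_ this
  rintro _ ⟨c, hc, rfl⟩
  -- Error terms keep the group exponents of `a + b`, so strictness comes from the `Δ` part alone.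
  refine ⟨Sum.elim c ((a + b) ∘ Sum.inr), ?_, rfl⟩
  have hc' := Pi.lt_def.1 (Set.mem_Iio.1 hc)
  refine Pi.lt_def.2 ⟨?_, ?_⟩
  · rintro (i | i)
    · exact hc'.1 i
    · exact le_rfl
  · obtain ⟨i, hi⟩ := hc'.2
    exact ⟨Sum.inl i, hi⟩

theorem exists_skewMonomial_eq (a : Fin n ⊕ Fin n → ℕ) (γ : Multiplicative (Fin n → ℤ)) :
    ∃ b, Q.skewMonomial b = single γ (Delta.monomial Q a) := by
  refine ⟨Sum.elim a (Sum.elim (fun i => (γ.toAdd i).toNat) fun i => (-γ.toAdd i).toNat), ?_⟩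
  rw [skewMonomial]
  congr 1
  refine Multiplicative.toAdd.injective (funext fun i => ?_)
  simp only [groupPart, toAdd_ofAdd, Sum.elim_inr, Sum.elim_inl]
  omega

theorem span_skewMonomial : Submodule.span K (Set.range Q.skewMonomial) = ⊤ := by
  refine eq_top_iff.2 fun f _ => ?_
  induction f using SkewMonoidAlgebra.induction_on with
  | zero => exact zero_mem _
  | single γ r =>
    have hr : r ∈ Submodule.span K (Set.range (Delta.monomial Q)) := by
      rw [Delta.span_monomial]
      trivial
    have := Submodule.mem_map_of_mem (f := lsingle K γ) hr
    rw [Submodule.map_span] at this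
    refine Submodule.span_mono ?_ this
    rintro _ ⟨_, ⟨a, rfl⟩, rfl⟩
    exact Q.exists_skewMonomial_eq a γ
  | add f g hf hg => exact add_mem (hf trivial) (hg trivial)

theorem skewMonomial_zero : Q.skewMonomial 0 = 1 := by
  rw [skewMonomial, Pi.zero_comp, Delta.monomial_zero]
  congr 1

theorem isNoetherianRing_skewGroupAlgebra : IsNoetherianRing Q.SkewGroupAlgebra :=
  Q.hasLeadingProducts_skewMonomial.isNoetherianRing Q.span_skewMonomial

theorem isNoetherianRing_skewGroupAlgebra_op : IsNoetherianRing (Q.SkewGroupAlgebra)ᵐᵒᵖ :=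
  Q.hasLeadingProducts_skewMonomial.isNoetherianRing_op Q.span_skewMonomial

theorem isDomain_skewGroupAlgebra [CharZero K] : IsDomain Q.SkewGroupAlgebra := by
  have : NoZeroDivisors Q.Delta := (Delta.hasLeadingProducts Q).noZeroDivisors
    (Delta.span_monomial Q) (Delta.linearIndependent_monomial Q)
  have : NoZeroDivisors Q.SkewGroupAlgebra := SkewMonoidAlgebra.noZeroDivisors
  exact NoZeroDivisors.to_isDomain _

end

end QMatrix

/-! ### Simplicity of `Δ # ℤⁿ` -/

namespace QMatrix

noncomputable section

variable {n : ℕ} {K : Type*} [Field K] (Q : QMatrix n K)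

open SkewMonoidAlgebra

/-- The values at the identity of the elements of a left ideal with support in `S`. -/
def coeffOneSubmodule (I : Ideal Q.SkewGroupAlgebra) (S : Finset (Multiplicative (Fin n → ℤ))) :
    Submodule K Q.Delta where
  carrier := {a | ∃ g ∈ I, g.support ⊆ S ∧ g.coeff 1 = a}
  zero_mem' := ⟨0, I.zero_mem, by simp, by simp⟩
  add_mem' := by
    classical
    rintro _ _ ⟨f, hf, hfS, rfl⟩ ⟨g, hg, hgS, rfl⟩
    exact ⟨f + g, I.add_mem hf hg, support_add.trans (Finset.union_subset hfS hgS), by simp⟩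
  smul_mem' := by
    rintro c _ ⟨f, hf, hfS, rfl⟩
    refine ⟨c • f, ?_, fun x hx => hfS ?_, by simp⟩
    · rw [Algebra.smul_def]
      exact I.mul_mem_left _ hf
    · rw [mem_support_iff] at hx ⊢
      intro h
      rw [coeff_smul, Finsupp.smul_apply, h, smul_zero] at hx
      exact hx rfl

/-- The twist is conjugation by `σ_{e_i}`, so each skew commutator can be formed inside the
two-sided ideal. Neither conjugation nor multiplication by elements of `Δ` enlarges the support, and
at `1` the result is the commutator of the coefficient. -/
theorem lowering_mem_coeffOneSubmodule {I : Ideal Q.SkewGroupAlgebra} (hI : I.IsTwoSided)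
    (S : Finset (Multiplicative (Fin n → ℤ))) (s : Fin n ⊕ Fin n) (f : Q.Delta)
    (hf : f ∈ Q.coeffOneSubmodule I S) : Delta.lowering Q s f ∈ Q.coeffOneSubmodule I S := by
  obtain ⟨g, hg, hgS, rfl⟩ := hf
  have hz : ∀ x ∉ S, g.coeff x = 0 := fun x hx => notMem_support_iff.1 fun h => hx (hgS h)
  have hconj : ∀ i : Fin n, single (Multiplicative.ofAdd (Pi.single i 1 : Fin n → ℤ)) (1 : Q.Delta) * g *
      single (Multiplicative.ofAdd (Pi.single i 1 : Fin n → ℤ))⁻¹ 1 ∈ I := fun i =>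
    I.mul_mem_right _ (I.mul_mem_left _ hg)
  rcases s with i | i
  · refine ⟨_, I.sub_mem (I.mul_mem_left (single 1 (Delta.delta Q i)) hg)
      (I.mul_mem_right (single 1 (Delta.delta Q i)) (hconj i)), ?_, ?_⟩
    · intro x hx
      by_contra hxS
      rw [mem_support_iff, coeff_sub, Finsupp.sub_apply, coeff_single_one_mul,
        coeff_mul_single_one, coeff_conj_single, hz x hxS] at hx
      simp at hx
    · rw [coeff_sub, Finsupp.sub_apply, coeff_single_one_mul, coeff_mul_single_one,
        coeff_conj_single, one_smul]
      rfl
  · refine ⟨_, I.sub_mem (I.mul_mem_right (single 1 (Delta.rho Q i)) hg)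
      (I.mul_mem_left (single 1 (Delta.rho Q i)) (hconj i)), ?_, ?_⟩
    · intro x hx
      by_contra hxS
      rw [mem_support_iff, coeff_sub, Finsupp.sub_apply, coeff_single_one_mul,
        coeff_mul_single_one, coeff_conj_single, hz x hxS] at hx
      simp at hx
    · rw [coeff_sub, Finsupp.sub_apply, coeff_single_one_mul, coeff_mul_single_one,
        coeff_conj_single, one_smul]
      rfl

theorem monomial_single_inl (i : Fin n) :
    Delta.monomial Q (Pi.single (Sum.inl i) 1) = Delta.rho Q i := by
  obtain ⟨l, l', e, hl, hl'⟩ := exists_finRange_eq i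
  have h1 : (Pi.single (Sum.inl i) 1 : Fin n ⊕ Fin n → ℕ) ∘ Sum.inl = Pi.single i 1 := by
    ext j; by_cases h : j = i <;> simp [Pi.single_apply]
  have h2 : (Pi.single (Sum.inl i) 1 : Fin n ⊕ Fin n → ℕ) ∘ Sum.inr = 0 := by
    ext j; simp
  have h3 : ∀ j ≠ i, (Pi.single i 1 : Fin n → ℕ) j = (0 : Fin n → ℕ) j := fun j hj => by simp [hj]
  rw [Delta.monomial, h1, h2, Delta.rhoMonomial_eq, Delta.deltaMonomial_eq, orderedMonomial_zero,
    mul_one, orderedMonomial_eq_map, e, List.map_append, List.prod_append, List.map_cons,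
    List.prod_cons, map_pow_congr _ h3 hl, map_pow_congr _ h3 hl']
  simp

/-- A twisted-central element of `Δ` for a non-trivial group element vanishes. -/
theorem eq_zero_of_twisted_central [CharZero K] {i : Fin n} {c : K} (hc : c ≠ 1) {a : Q.Delta}
    (h1 : Delta.twist Q i a = a) (h2 : Delta.rho Q i * a = c • (a * Delta.rho Q i)) : a = 0 := by
  refine (Delta.hasLeadingProducts Q).eq_zero_of_mul_eq (Delta.span_monomial Q)
    (Delta.linearIndependent_monomial Q) (b := Pi.single (Sum.inl i) 1)
    (fun h => by simpa using congrFun h (Sum.inl i))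
    -- The hypotheses turn the skew commutator of `a` with `ρ_i` into `(1 - c) a ρ_i`, so `a ρ_i`
    -- equals this `D a`.
    (D := (1 - c)⁻¹ • Delta.lowering Q (Sum.inr i)) (fun b => ?_) ?_
  · rw [LinearMap.smul_apply, Delta.lowering_monomial]
    exact Submodule.smul_mem _ _ (Submodule.smul_mem _ _
      (Submodule.subset_span ⟨_, Set.mem_Iic.2 tsub_le_self, rfl⟩))
  · have h : Delta.lowering Q (Sum.inr i) a = (1 - c) • (a * Delta.rho Q i) := by
      refine (Delta.rhoCommutator_apply Q i a).trans ?_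
      rw [h1, h2, sub_smul, one_smul]
    rw [LinearMap.smul_apply, h, smul_smul, inv_mul_cancel₀ (sub_ne_zero.2 hc.symm), one_smul,
      monomial_single_inl]

theorem isSimpleRing_skewGroupAlgebra [CharZero K]
    (hβ : ∀ a : Fin n → ℤ, (∀ j, Q.bichar a (Pi.single j 1) = 1) → a = 0) :
    IsSimpleRing Q.SkewGroupAlgebra := by
  classical
  rw [isSimpleRing_iff_isTwoSided_imp]
  refine ⟨inferInstance, fun I hI => or_iff_not_imp_left.2 fun hbot => ?_⟩
  obtain ⟨f₀, ⟨hf₀, hf₀0⟩, hmin⟩ := (measure fun f : Q.SkewGroupAlgebra => f.support.card).wf.has_min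
    {f | f ∈ I ∧ f ≠ 0} (by
      obtain ⟨f, hf, h0⟩ := Submodule.exists_mem_ne_zero_of_ne_bot hbot
      exact ⟨f, hf, h0⟩)
  obtain ⟨γ, hγ⟩ := Finset.nonempty_iff_ne_empty.2 (mt support_eq_empty.1 hf₀0)
  set f := f₀ * single γ⁻¹ 1 with hfdef
  have hf : f ∈ I := I.mul_mem_right _ hf₀
  have hf1 : f.coeff 1 ≠ 0 := by
    rw [hfdef, coeff_mul_single, smul_one, mul_one, inv_inv, one_mul]
    exact mem_support_iff.1 hγ
  have hcard : f.support.card ≤ f₀.support.card :=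
    (Finset.card_le_card (support_mul_single_subset _ _ _)).trans Finset.card_image_le
  -- Such a `g` has strictly smaller support than the minimal element, since it misses `1`.
  have hvanish : ∀ g ∈ I, g.support ⊆ f.support → g.coeff 1 = 0 → g = 0 := by
    intro g hg hgS hg1
    by_contra h0
    refine hmin g ⟨hg, h0⟩ (lt_of_lt_of_le (Finset.card_lt_card ?_) hcard)
    exact (Finset.ssubset_iff_of_subset hgS).2
      ⟨1, mem_support_iff.2 hf1, notMem_support_iff.2 hg1⟩
  obtain ⟨g, hg, hgS, hg1⟩ : (1 : Q.Delta) ∈ Q.coeffOneSubmodule I f.support :=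
    one_mem_of_lowering (Delta.span_monomial Q) (Delta.loweringScalar_ne_zero Q)
      (Delta.lowering_monomial Q) (Delta.monomial_zero Q)
      (Q.lowering_mem_coeffOneSubmodule hI f.support) ⟨f, hf, subset_rfl, rfl⟩ hf1
  have hz : ∀ x ∉ f.support, g.coeff x = 0 := fun x hx =>
    notMem_support_iff.1 fun h => hx (hgS h)
  -- The coefficient of `g` at `1` is now `1`, so `σ_h g σ_h⁻¹ - g`, and below the commutator with
  -- `ρ_i`, vanish at `1` and hence everywhere.
  have hfix : ∀ h x : Multiplicative (Fin n → ℤ), h • g.coeff x = g.coeff x := by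
    intro h x
    have := hvanish (single h 1 * g * single h⁻¹ 1 - g)
      (I.sub_mem (I.mul_mem_right _ (I.mul_mem_left _ hg)) hg) (fun y hy => by
        by_contra hyS
        rw [mem_support_iff, coeff_sub, Finsupp.sub_apply, coeff_conj_single, hz y hyS] at hy
        simp at hy)
      (by rw [coeff_sub, Finsupp.sub_apply, coeff_conj_single, hg1, smul_one, sub_self])
    have := DFunLike.congr_fun (congrArg SkewMonoidAlgebra.coeff this) x
    rwa [coeff_sub, Finsupp.sub_apply, coeff_conj_single, coeff_zero, Finsupp.zero_apply,
      sub_eq_zero] at this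
  have hcomm : ∀ i x, Delta.rho Q i * g.coeff x = g.coeff x * x • Delta.rho Q i := by
    intro i x
    have := hvanish (single 1 (Delta.rho Q i) * g - g * single 1 (Delta.rho Q i))
      (I.sub_mem (I.mul_mem_left _ hg) (I.mul_mem_right _ hg)) (fun y hy => by
        by_contra hyS
        rw [mem_support_iff, coeff_sub, Finsupp.sub_apply, coeff_single_one_mul,
          coeff_mul_single_one, hz y hyS] at hy
        simp at hy)
      (by rw [coeff_sub, Finsupp.sub_apply, coeff_single_one_mul, coeff_mul_single_one, hg1,
        one_smul, mul_one, one_mul, sub_self])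
    have := DFunLike.congr_fun (congrArg SkewMonoidAlgebra.coeff this) x
    rwa [coeff_sub, Finsupp.sub_apply, coeff_single_one_mul, coeff_mul_single_one, coeff_zero,
      Finsupp.zero_apply, sub_eq_zero] at this
  have hzero : ∀ x ≠ 1, g.coeff x = 0 := by
    intro x hx
    obtain ⟨i, hi⟩ : ∃ i, Q.bichar x.toAdd (Pi.single i 1) ≠ 1 := by
      by_contra! h
      exact hx (Multiplicative.toAdd.injective (hβ _ h))
    refine Q.eq_zero_of_twisted_central (i := i) (c := (Q.bichar x.toAdd (Pi.single i 1) : K))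
      (fun h => hi (Units.ext h)) (hfix _ x) ?_
    have h : x • Delta.rho Q i = (Q.bichar x.toAdd (Pi.single i 1) : K) • Delta.rho Q i :=
      Q.smul_rho x.toAdd i
    rw [hcomm, h, mul_smul_comm]
  have : g = 1 := by
    ext x
    by_cases hx : x = 1
    · rw [hx, hg1, coeff_one, Finsupp.single_eq_same]
    · rw [hzero x hx, coeff_one, Finsupp.single_eq_of_ne hx]
  exact (Ideal.eq_top_iff_one I).2 (this ▸ hg)

/-! ### Growth of `Δ # ℤⁿ` -/

/-- The elements whose exponents are bounded by `s`. -/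
def boxSubmodule (s : ℕ) : Submodule K Q.SkewGroupAlgebra :=
  Submodule.span K (Q.skewMonomial '' Set.Iic fun _ => s)

theorem boxSubmodule_mono {s t : ℕ} (h : s ≤ t) : Q.boxSubmodule s ≤ Q.boxSubmodule t :=
  Submodule.span_mono (Set.image_mono (Set.Iic_subset_Iic.2 fun _ => h))

theorem one_le_boxSubmodule (s : ℕ) : 1 ≤ Q.boxSubmodule s := by
  rw [Submodule.one_le]
  exact Submodule.subset_span ⟨0, fun _ => Nat.zero_le _, Q.skewMonomial_zero⟩

theorem boxSubmodule_pow_le (s m : ℕ) : Q.boxSubmodule s ^ m ≤ Q.boxSubmodule (s * m) := by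
  induction m with
  | zero => simpa using Q.one_le_boxSubmodule 0
  | succ m ih =>
    rw [pow_succ]
    exact (mul_le_mul' ih le_rfl).trans (Q.hasLeadingProducts_skewMonomial.span_mul_span_le _ _)

theorem exists_mem_boxSubmodule (f : Q.SkewGroupAlgebra) : ∃ s, f ∈ Q.boxSubmodule s := by
  have hf : f ∈ Submodule.span K (Set.range Q.skewMonomial) := by
    rw [span_skewMonomial]
    trivial
  induction hf using Submodule.span_induction with
  | mem f h =>
    obtain ⟨a, rfl⟩ := h
    exact ⟨Finset.univ.sup a, Submodule.subset_span
      ⟨a, fun i => Finset.le_sup (Finset.mem_univ i), rfl⟩⟩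
  | zero => exact ⟨0, zero_mem _⟩
  | add f g _ _ hf hg =>
    obtain ⟨s, hs⟩ := hf
    obtain ⟨t, ht⟩ := hg
    exact ⟨max s t, add_mem (Q.boxSubmodule_mono (le_max_left _ _) hs)
      (Q.boxSubmodule_mono (le_max_right _ _) ht)⟩
  | smul c f _ hf =>
    obtain ⟨s, hs⟩ := hf
    exact ⟨s, Submodule.smul_mem _ _ hs⟩

theorem exists_le_boxSubmodule (V : Submodule K Q.SkewGroupAlgebra) (hV : FiniteDimensional K V) :
    ∃ s, V ≤ Q.boxSubmodule s := by
  obtain ⟨S, rfl⟩ := Module.Finite.iff_fg.1 hV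
  choose s hs using Q.exists_mem_boxSubmodule
  exact ⟨S.sup s, Submodule.span_le.2 fun f hf =>
    Q.boxSubmodule_mono (Finset.le_sup hf) (hs f)⟩

/-- The `4n` exponents are redundant: only the difference of the two group parts matters, and it
lies in `[-s, s]^n`, which brings the power down to `3n`. -/
theorem boxSubmodule_le_span (s : ℕ) : ∃ S : Finset Q.SkewGroupAlgebra,
    S.card ≤ (2 * s + 1) ^ (3 * n) ∧ Q.boxSubmodule s ≤ Submodule.span K S := by
  classical
  refine ⟨((Finset.Iic fun _ : Fin n ⊕ Fin n => s) ×ˢ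
    Finset.Icc (fun _ : Fin n => -(s : ℤ)) fun _ => (s : ℤ)).image
      fun p => single (Multiplicative.ofAdd p.2) (Delta.monomial Q p.1), ?_, ?_⟩
  · refine Finset.card_image_le.trans ?_
    have h1 : (Finset.Iic fun _ : Fin n ⊕ Fin n => s).card = (s + 1) ^ (n + n) := by
      simp [Pi.card_Iic]
    have h2 : (Finset.Icc (fun _ : Fin n => -(s : ℤ)) fun _ => (s : ℤ)).card =
        (2 * s + 1) ^ n := by
      rw [Pi.card_Icc]
      simp only [Int.card_Icc, Finset.prod_const, Finset.card_univ, Fintype.card_fin]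
      congr 1
      omega
    rw [Finset.card_product, h1, h2]
    calc (s + 1) ^ (n + n) * (2 * s + 1) ^ n ≤ (2 * s + 1) ^ (n + n) * (2 * s + 1) ^ n :=
          Nat.mul_le_mul_right _ (Nat.pow_le_pow_left (by omega) _)
      _ = (2 * s + 1) ^ (3 * n) := by rw [← pow_add]; congr 1; ring
  · refine Submodule.span_mono ?_
    rintro _ ⟨a, ha, rfl⟩
    refine Finset.mem_coe.2 (Finset.mem_image.2 ⟨(a ∘ Sum.inl, groupPart a), ?_, rfl⟩)
    have ha' : ∀ i, a i ≤ s := ha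
    rw [Finset.mem_product, Finset.mem_Iic, Finset.mem_Icc]
    refine ⟨fun i => ha' _, fun i => ?_, fun i => ?_⟩
    · have := ha' (Sum.inr (Sum.inr i))
      simp only [groupPart]
      omega
    · have := ha' (Sum.inr (Sum.inl i))
      simp only [groupPart]
      omega

theorem finrank_pow_le (V : Submodule K Q.SkewGroupAlgebra) (hV : FiniteDimensional K V) :
    ∃ C : ℕ, 0 < C ∧ ∀ m, 1 ≤ m →
      Module.finrank K ((1 ⊔ V) ^ m : Submodule K Q.SkewGroupAlgebra) ≤ C * m ^ (3 * n) := by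
  obtain ⟨s, hs⟩ := Q.exists_le_boxSubmodule V hV
  -- The constant comes from `2 s m + 1 ≤ (2 s + 1) m` for `m ≥ 1`.
  refine ⟨(2 * s + 1) ^ (3 * n), by positivity, fun m hm => ?_⟩
  obtain ⟨S, hS, hS'⟩ := Q.boxSubmodule_le_span (s * m)
  have hle : (1 ⊔ V) ^ m ≤ Submodule.span K (S : Set Q.SkewGroupAlgebra) :=
    (pow_le_pow_left' (sup_le (Q.one_le_boxSubmodule s) hs) m).trans
      ((Q.boxSubmodule_pow_le s m).trans hS')
  refine (Submodule.finrank_mono hle).trans ((finrank_span_finset_le_card S).trans (hS.trans ?_))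
  rw [← mul_pow]
  refine Nat.pow_le_pow_left ?_ _
  nlinarith

theorem orderedMonomial_mem_pow {A : Type*} [Ring A] [Algebra K A] {W : Submodule K A}
    (hW : 1 ≤ W) {y : Fin n → A} (hy : ∀ i, y i ∈ W) {a : Fin n → ℕ} {k : ℕ} (ha : ∀ i, a i ≤ k) :
    orderedMonomial y a ∈ W ^ (n * k) := by
  have h : ∀ l : List (Fin n), (l.map fun i => y i ^ a i).prod ∈ W ^ (l.length * k) := by
    intro l
    induction l with
    | nil => simpa using ⟨(1 : K), map_one _⟩
    | cons i l ih =>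
      rw [List.map_cons, List.prod_cons, List.length_cons, add_mul, one_mul, add_comm, pow_add]
      exact Submodule.mul_mem_mul
        (pow_le_pow_right₀ hW (ha i) (Submodule.pow_mem_pow W (hy i) _)) ih
  simpa [orderedMonomial_eq_map] using h (List.finRange n)

theorem map_orderedMonomial_monoidHom {A B : Type*} [Ring A] [Ring B] (φ : A →* B)
    (y : Fin n → A) (a : Fin n → ℕ) :
    φ (orderedMonomial y a) = orderedMonomial (fun i => φ (y i)) a := by
  rw [orderedMonomial, orderedMonomial, map_list_prod, List.map_ofFn]
  congr 2
  ext i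
  simp

theorem single_natCast (a : Fin n → ℕ) :
    (single (Multiplicative.ofAdd fun i => (a i : ℤ)) 1 : Q.SkewGroupAlgebra) =
      orderedMonomial (fun i => single (Multiplicative.ofAdd (Pi.single i 1 : Fin n → ℤ)) 1) a := by
  have h : (Multiplicative.ofAdd fun i => (a i : ℤ)) =
      (List.ofFn fun i => Multiplicative.ofAdd (Pi.single i 1 : Fin n → ℤ) ^ a i).prod := by
    rw [List.prod_ofFn]
    refine Multiplicative.toAdd.injective ?_
    ext j
    simp [toAdd_prod, Finset.sum_apply, Pi.single_apply]
  have := map_list_prod (of Q.Delta (Multiplicative (Fin n → ℤ)))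
    (List.ofFn fun i => Multiplicative.ofAdd (Pi.single i 1 : Fin n → ℤ) ^ a i)
  rw [← h, List.map_ofFn] at this
  refine this.trans ?_
  rw [orderedMonomial]
  congr 2
  ext1 i
  exact map_pow (of Q.Delta (Multiplicative (Fin n → ℤ))) _ _

/-- The generators of `Δ # ℤⁿ`, without the inverses of the `σ_{e_i}`. -/
def skewGen : (Fin n ⊕ Fin n) ⊕ Fin n → Q.SkewGroupAlgebra :=
  Sum.elim (fun s => single 1 (Delta.gen Q s))
    fun i => single (Multiplicative.ofAdd (Pi.single i 1 : Fin n → ℤ)) 1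

theorem le_finrank_pow [CharZero K] (hn : 0 < n) : ∃ V : Submodule K Q.SkewGroupAlgebra,
    FiniteDimensional K V ∧ ∃ C : ℕ, 0 < C ∧ ∀ m, 1 ≤ m →
      m ^ (3 * n) ≤ C * Module.finrank K ((1 ⊔ V) ^ m : Submodule K Q.SkewGroupAlgebra) := by
  set V := Submodule.span K (Set.range Q.skewGen) with hV
  have hVfin : FiniteDimensional K V := FiniteDimensional.span_of_finite K (Set.finite_range _)
  -- The constant absorbs the rounding in `k = m / (3 n)`, through `m < 3 n (k + 1)`.
  refine ⟨V, hVfin, (3 * n) ^ (3 * n), by positivity, fun m _ => ?_⟩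
  set W := 1 ⊔ V with hWdef
  have hW : 1 ≤ W := le_sup_left
  have hgen : ∀ s, Q.skewGen s ∈ W := fun s =>
    Submodule.mem_sup_right (Submodule.subset_span ⟨s, rfl⟩)
  have hWfg : W.FG := Submodule.FG.sup
    (Submodule.one_eq_span (R := K) (A := Q.SkewGroupAlgebra) ▸ Submodule.fg_span_singleton 1)
    (Module.Finite.iff_fg.1 hVfin)
  have hfin : FiniteDimensional K (W ^ m : Submodule K Q.SkewGroupAlgebra) :=
    Module.Finite.iff_fg.2 (hWfg.pow m)
  set k := m / (3 * n) with hk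
  have hkm : n * k + n * k + n * k ≤ m := by
    have := Nat.mul_div_le m (3 * n)
    rw [← hk] at this
    linarith
  -- Non-negative exponents of the `σ_{e_i}` already give enough basis elements; each is a product
  -- of at most `3 n k ≤ m` generators.
  let e : (Fin n → Fin (k + 1)) × (Fin n → Fin (k + 1)) × (Fin n → Fin (k + 1)) →
      (Fin n → ℕ) × (Fin n → ℕ) × (Fin n → ℤ) :=
    fun p => (fun i => p.1 i, fun i => p.2.1 i, fun i => ((p.2.2 i : ℕ) : ℤ))
  have he : Function.Injective e := by
    rintro ⟨a, b, c⟩ ⟨a', b', c'⟩ h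
    simp only [e, Prod.mk.injEq, funext_iff] at h
    refine Prod.ext (funext fun i => Fin.ext (h.1 i)) (Prod.ext (funext fun i => Fin.ext (h.2.1 i))
      (funext fun i => Fin.ext ?_))
    exact_mod_cast h.2.2 i
  have hmem : ∀ p, Q.skewBasis (e p) ∈ W ^ m := by
    rintro ⟨a, b, c⟩
    have hb : ∀ (a : Fin n → Fin (k + 1)) i, (a i : ℕ) ≤ k := fun a i => Nat.lt_succ_iff.1 (a i).2
    have h1 : (single 1 (Q.rhoMonomial fun i => a i) : Q.SkewGroupAlgebra) ∈ W ^ (n * k) := by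
      have := map_orderedMonomial_monoidHom
        (singleOneRingHom : Q.Delta →+* Q.SkewGroupAlgebra).toMonoidHom (Delta.rho Q) fun i => a i
      refine Set.mem_of_eq_of_mem this (orderedMonomial_mem_pow hW (fun i => ?_) (hb a))
      exact hgen (Sum.inl (Sum.inl i))
    have h2 : (single 1 (Q.deltaMonomial fun i => b i) : Q.SkewGroupAlgebra) ∈ W ^ (n * k) := by
      have := map_orderedMonomial_monoidHom
        (singleOneRingHom : Q.Delta →+* Q.SkewGroupAlgebra).toMonoidHom (Delta.delta Q) fun i => b i
      refine Set.mem_of_eq_of_mem this (orderedMonomial_mem_pow hW (fun i => ?_) (hb b))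
      exact hgen (Sum.inl (Sum.inr i))
    have h3 : (single (Multiplicative.ofAdd fun i => ((c i : ℕ) : ℤ)) 1 : Q.SkewGroupAlgebra) ∈
        W ^ (n * k) := by
      rw [single_natCast Q fun i => (c i : ℕ)]
      exact orderedMonomial_mem_pow hW (fun i => hgen (Sum.inr i)) (hb c)
    have := Submodule.mul_mem_mul (Submodule.mul_mem_mul h1 h2) h3
    rw [← pow_add, ← pow_add, single_mul_single_mul_single, ← skewBasis_apply] at this
    exact pow_le_pow_right₀ hW hkm this
  have hcard : (k + 1) ^ (3 * n) ≤ Module.finrank K (W ^ m : Submodule K Q.SkewGroupAlgebra) := by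
    have hli := Q.skewBasis.linearIndependent.comp e he
    have h := finrank_span_eq_card hli
    have hle : Submodule.span K (Set.range (Q.skewBasis ∘ e)) ≤ W ^ m := by
      refine Submodule.span_le.2 ?_
      rintro _ ⟨p, rfl⟩
      exact hmem p
    have := Submodule.finrank_mono hle
    rw [h] at this
    refine le_trans (le_of_eq ?_) this
    simp only [Fintype.card_prod, Fintype.card_pi, Fintype.card_fin, Finset.prod_const,
      Finset.card_univ]
    ring
  calc m ^ (3 * n) ≤ (3 * n * (k + 1)) ^ (3 * n) :=
        Nat.pow_le_pow_left (Nat.lt_mul_div_succ m (by omega)).le _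
    _ = (3 * n) ^ (3 * n) * (k + 1) ^ (3 * n) := mul_pow _ _ _
    _ ≤ _ := Nat.mul_le_mul_left _ hcard

theorem gkDim_skewGroupAlgebra [CharZero K] (hn : 0 < n) :
    gkDim K Q.SkewGroupAlgebra = ((3 * n : ℕ) : EReal) :=
  gkDim_eq_of_growth Q.finrank_pow_le (Q.le_finrank_pow hn)

end

end QMatrix

theorem mainTheorem9 {K : Type*} [Field K] [CharZero K] {n : ℕ} (hn : 3 ≤ n) (Q : QMatrix n K)
    (hq : AlgebraicIndependent ℚ
      (fun p : {p : Fin n × Fin n // p.1 < p.2} => (Q.q p.1.1 p.1.2 : K))) :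
    IsNoetherianRing Q.SkewGroupAlgebra ∧
    IsNoetherianRing (Q.SkewGroupAlgebra)ᵐᵒᵖ ∧
    IsSimpleRing Q.SkewGroupAlgebra ∧
    IsDomain Q.SkewGroupAlgebra ∧
    (∃ b : Module.Basis ((Fin n → ℕ) × (Fin n → ℕ) × (Fin n → ℤ)) K Q.SkewGroupAlgebra,
      ∀ (I J : Fin n → ℕ) (γ : Fin n → ℤ),
        b (I, J, γ) = SkewMonoidAlgebra.single 1 (Q.rhoMonomial I) *
          SkewMonoidAlgebra.single 1 (Q.deltaMonomial J) *
          SkewMonoidAlgebra.single (Multiplicative.ofAdd γ) 1) ∧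
    gkDim K Q.SkewGroupAlgebra = ((3 * n : ℕ) : EReal) :=
  ⟨Q.isNoetherianRing_skewGroupAlgebra, Q.isNoetherianRing_skewGroupAlgebra_op,
    Q.isSimpleRing_skewGroupAlgebra fun _ => Q.eq_zero_of_bichar_eq_one (by omega) hq,
    Q.isDomain_skewGroupAlgebra,
    ⟨Q.skewBasis, fun I J γ => by 
      rw [QMatrix.skewBasis_apply, QMatrix.single_mul_single_mul_single]⟩,
    Q.gkDim_skewGroupAlgebra (by omega)⟩
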